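/- Fix a primitive recursive presentation of the rationals with domain $\mathbb{N}$, i.e. a bijection between $\mathbb{N}$ and $\mathbb{Q}$ under which the order $<_{\mathbb{Q}}$ becomes a primitive recursive relation on $\mathbb{N}$. Computability of sets of rationals, and the codes of finite sets of rationals, refer to it. \textbf{Definitions.} An \emph{$m$-by-$n$ matrix} $M$ ($m,n\ge 0$) is an array $(x_{i,j})_{i<m,\,j<n}$ of rationals with strictly increasing rows. For $i<m$, $\mathrm{int}(M(i))$ is the family of the $n+1$ open intervals $(-\infty,x_{i,0}),(x_{i,0},x_{i,1}),\dots,(x_{i,n-1},+\infty)$ of $\mathbb{Q}$ (for $n=0$ the only interval is $\mathbb{Q}$), and $\mathrm{int}(M)$ is the family of all nonempty sets $\bigcap_{i<m} I_i$ with $I_i\in\mathrm{int}(M(i))$ (for $m=0$, $\mathrm{int}(M)=\{\mathbb{Q}\}$). An \emph{$M$-type} is a tuple $(T_j)_{j<n}$ of members of $\mathrm{int}(M)$. An \emph{$M$-valuation} $(\vec R,\vec S)$ consists of finite sets $R_j\subseteq\mathbb{Q}$ ($j<n$) and $S_{i,I}\subseteq I$ ($i<m$, $I\in\mathrm{int}(M(i))$);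 it is \emph{of type} $\vec T$ if $R_j\subseteq T_j$ for all $j<n$, and $(\vec R,\vec S)>s$ means that all rationals occurring in it have a name greater than $s$ in $\mathbb{N}$. An \emph{$M$-formula} $\varphi(\vec U,\vec V)$ has finite (coded) set variables $U_j$ ($j<n$) and $V_{i,I}$ ($i<m$, $I\in\mathrm{int}(M(i))$). It is \emph{essential} if for every $s\in\omega$ there are an $M$-type $\vec T$ and an $M$-valuation $(\vec R,\vec S)>s$ of type $\vec T$ such that $\varphi(\vec R,\vec S)$ holds. An $M$-valuation \emph{diagonalizes} against $A_0,A_1\subseteq\mathbb{Q}$ if $\bigcup_{j<n} R_j\subseteq A_1$ and for every $i<m$ there is some $I\in\mathrm{int}(M(i))$ with $S_{i,I}\subseteq A_0$. A set $X\subseteq\omega$ is \emph{fair} for $A_0,A_1$ if for all $m,n\in\omega$, every $m$-by-$n$ matrix $M$ and every essential $\Sigma^{0,X}_1$ $M$-formula $\varphi$, there is an $M$-valuation $(\vec R,\vec S)$ diagonalizing against $A_0,A_1$ such that $\varphi(\vec R,\vec S)$ holds. A \emph{Scott set} is a set $\mathcal{S}\subseteq 2^{\omega}$ that is closed downwards under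 Turing reducibility and closed under the join $\oplus$, and such that every infinite binary tree in $\mathcal{S}$ has an infinite path in $\mathcal{S}$. A set $D\subseteq\mathbb{Q}$ is called \emph{dense} if $D$ has at least two elements and $(D,<_{\mathbb{Q}})$ is a dense linear order, i.e. for all $x<y$ in $D$ there is $z\in D$ with $x<z<y$. \textbf{Theorem.} Let $A_0,A_1\subseteq\mathbb{Q}$ be disjoint, and let $\mathcal{S}$ be a Scott set all of whose members are fair for $A_0,A_1$. Then for every $C\in\mathcal{S}$, every $k\in\omega$ and every $C$-computable coloring $f:[\omega]^2\to k$, there is an infinite $f$-homogeneous set $H$ such that $H\oplus C$ computes neither an infinite subset of $A_0$ nor a dense subset of $A_1$. -/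

import Mathlib

namespace ERFair

/-! ### Computability relative to a set of natural numbers -/

open Classical in
/-- The characteristic function of `X`, as an oracle. -/
noncomputable def charFun (X : Set ℕ) : ℕ →. ℕ :=
  fun n => Part.some (if n ∈ X then 1 else 0)

/-- `Y ≤_T X`. -/
def SetReducible (Y X : Set ℕ) : Prop :=
  TuringReducible (charFun Y) (charFun X)

/-- The effective join `X ⊕ Y = {2n : n ∈ X} ∪ {2n + 1 : n ∈ Y}`. -/
def join (X Y : Set ℕ) : Set ℕ :=
  {a | ∃ n ∈ X, a = 2 * n} ∪ {a | ∃ n ∈ Y, a = 2 * n + 1}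

/-- `φ` is `Σ⁰₁` relative to `X`, i.e. it is the domain of a partial `X`-computable function. -/
def SigmaOne {α : Type} [Primcodable α] (X : Set ℕ) (φ : α → Prop) : Prop :=
  RecursiveIn {charFun X} (fun a => Part.assert (φ a) fun _ => Part.some ())

/-! ### Scott sets -/

/-- A binary tree: a set of finite strings closed under initial segments. -/
def IsBinaryTree (T : Set (List Bool)) : Prop :=
  ∀ σ ∈ T, ∀ τ : List Bool, τ <+: σ → τ ∈ T

open Classical in
/-- The string of the first `n` bits of (the characteristic function of) `P`. -/
noncomputable def initialSegment (P : Set ℕ) (n : ℕ) : List Bool :=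
  (List.range n).map fun i => decide (i ∈ P)

/-- `P` is an infinite path through `T`. -/
def IsPath (P : Set ℕ) (T : Set (List Bool)) : Prop :=
  ∀ n : ℕ, initialSegment P n ∈ T

/-- A Scott set. A set of strings is identified with the set of the codes of its elements. -/
structure IsScottSet (𝒮 : Set (Set ℕ)) : Prop where
  downward : ∀ X ∈ 𝒮, ∀ Y : Set ℕ, SetReducible Y X → Y ∈ 𝒮
  join_mem : ∀ X ∈ 𝒮, ∀ Y ∈ 𝒮, join X Y ∈ 𝒮
  path_mem : ∀ T : Set (List Bool), IsBinaryTree T → T.Infinite →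
    (Encodable.encode : List Bool → ℕ) '' T ∈ 𝒮 → ∃ P ∈ 𝒮, IsPath P T

/-! ### The rationals -/

/-- A primitive recursive presentation of `(ℚ, <)` with domain `ℕ`. -/
structure RatPresentation where
  enum : ℕ ≃ ℚ
  primrec_lt : PrimrecRel fun i j : ℕ => enum i < enum j

namespace RatPresentation

/-- The number naming the rational `q`. -/
def index (p : RatPresentation) (q : ℚ) : ℕ := p.enum.symm q

/-- The canonical code of a finite set of rationals, `∑ 2 ^ x` over the names `x` of
its elements. -/
def code (p : RatPresentation) (F : Finset ℚ) : ℕ := ∑ q ∈ F, 2 ^ p.index q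

/-- `X` computes the set `D` of rationals. -/
def Computes (p : RatPresentation) (X : Set ℕ) (D : Set ℚ) : Prop :=
  SetReducible (p.index '' D) X

end RatPresentation

/-- `(D, <)` is a dense linear order with more than one element. -/
def IsDenseSubset (D : Set ℚ) : Prop :=
  D.Nontrivial ∧ ∀ x ∈ D, ∀ y ∈ D, x < y → ∃ z ∈ D, x < z ∧ z < y

/-! ### Matrices, types, valuations -/

/-- An `m`-by-`n` matrix of rationals with strictly increasing rows. -/
structure RatMatrix (m n : ℕ) where
  entry : Fin m → Fin n → ℚ
  strictMono : ∀ i, StrictMono (entry i)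

namespace RatMatrix

variable {m n : ℕ}

/-- The `l`-th of the `n + 1` open intervals of the simple partition `int(M(i))`
given by the `i`-th row, `(-∞, x₀), (x₀, x₁), …, (xₙ₋₁, +∞)`. -/
def interval (M : RatMatrix m n) (i : Fin m) (l : Fin (n + 1)) : Set ℚ :=
  {q | (∀ j : Fin n, j.castSucc < l → M.entry i j < q) ∧
       (∀ j : Fin n, l ≤ j.castSucc → q < M.entry i j)}

/-- The simple partition `int(M)`, the product of the simple partitions of the rows:
its members are the (nonempty) intersections of one interval from each row. -/
def partition (M : RatMatrix m n) : Set (Set ℚ) :=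
  {I | I.Nonempty ∧ ∃ c : Fin m → Fin (n + 1), I = ⋂ i, M.interval i (c i)}

/-- An `M`-type. -/
def IsType (M : RatMatrix m n) (T : Fin n → Set ℚ) : Prop :=
  ∀ j, T j ∈ M.partition

end RatMatrix

/-- An `M`-valuation `(R, S)`; the set `S i l` belongs to the `l`-th interval of the row `i`. -/
structure Valuation {m n : ℕ} (M : RatMatrix m n) where
  R : Fin n → Finset ℚ
  S : Fin m → Fin (n + 1) → Finset ℚ
  subset_interval : ∀ i l, (S i l : Set ℚ) ⊆ M.interval i l

/-- An `M`-formula, given by its truth values on the tuples of finite sets of rationals. -/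
abbrev MFormula (m n : ℕ) : Type :=
  (Fin n → Finset ℚ) → (Fin m → Fin (n + 1) → Finset ℚ) → Prop

namespace Valuation

variable {m n : ℕ} {M : RatMatrix m n}

/-- The valuation satisfies `φ`. -/
def Satisfies (v : Valuation M) (φ : MFormula m n) : Prop := φ v.R v.S

/-- The valuation is of type `T`. -/
def OfType (v : Valuation M) (T : Fin n → Set ℚ) : Prop :=
  ∀ j, (v.R j : Set ℚ) ⊆ T j

/-- `(R, S) > s`: all rationals that occur have names greater than `s`. -/
def Above (p : RatPresentation) (v : Valuation M) (s : ℕ) : Prop :=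
  (∀ j, ∀ q ∈ v.R j, s < p.index q) ∧ (∀ i l, ∀ q ∈ v.S i l, s < p.index q)

/-- The valuation diagonalizes against `A₀, A₁`. -/
def Diagonalizes (v : Valuation M) (A₀ A₁ : Set ℚ) : Prop :=
  (∀ j, (v.R j : Set ℚ) ⊆ A₁) ∧ ∀ i, ∃ l, (v.S i l : Set ℚ) ⊆ A₀

end Valuation

namespace MFormula

variable {m n : ℕ}

/-- `φ` is a `Σ⁰₁` formula relative to `X`, in finite set variables that are given by codes. -/
def IsSigmaOne (p : RatPresentation) (X : Set ℕ) (φ : MFormula m n) : Prop :=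
  ∃ ψ : (Fin n → ℕ) × (Fin m → Fin (n + 1) → ℕ) → Prop, SigmaOne X ψ ∧
    ∀ R S, φ R S ↔ ψ (fun j => p.code (R j), fun i l => p.code (S i l))

/-- `φ`, as an `M`-formula, is essential. -/
def IsEssential (p : RatPresentation) (M : RatMatrix m n) (φ : MFormula m n) : Prop :=
  ∀ s : ℕ, ∃ T : Fin n → Set ℚ, M.IsType T ∧
    ∃ v : Valuation M, v.Above p s ∧ v.OfType T ∧ v.Satisfies φ

end MFormula

/-- `X` is fair for `A₀, A₁`. -/
def IsFair (p : RatPresentation) (A₀ A₁ : Set ℚ) (X : Set ℕ) : Prop :=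
  ∀ (m n : ℕ) (M : RatMatrix m n) (φ : MFormula m n),
    MFormula.IsSigmaOne p X φ → MFormula.IsEssential p M φ →
      ∃ v : Valuation M, v.Diagonalizes A₀ A₁ ∧ v.Satisfies φ

/-! ### Colorings of pairs -/

/-- The coloring of `[ω]²` that gives `{x, y}`, `x < y`, the color `f x y` is `C`-computable
(the values `f x y` for `y ≤ x` play no role). -/
def IsComputableColoring {k : ℕ} (C : Set ℕ) (f : ℕ → ℕ → Fin k) : Prop :=
  ∃ g : ℕ × ℕ →. ℕ, RecursiveIn {charFun C} g ∧ ∀ x y, x < y → (f x y : ℕ) ∈ g (x, y)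

/-- `H` is homogeneous for the coloring of `[ω]²` given by `f`. -/
def IsHomogeneous {k : ℕ} (f : ℕ → ℕ → Fin k) (H : Set ℕ) : Prop :=
  ∃ c : Fin k, ∀ x ∈ H, ∀ y ∈ H, x < y → f x y = c

end ERFair

/-!
The homogeneous set is built by Mathias forcing with reservoirs in the Scott set, in the manner of
Seetapun's argument for Ramsey's theorem for pairs. A condition has a finite homogeneous stem for
each of the `k` colors and one infinite reservoir, and each color `i` has to meet requirements on
the generic set `G i`: to be infinite, to compute (with `C`) no infinite subset of `A₀`, and to
compute no dense subset of `A₁`. It suffices that, given one requirement for each color, some color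
always makes progress (`exists_advances`): if every color failed some requirement in the limit, the
tuple of these requirements would be a counterexample (`exists_generic`).

The density of a set enters only through the following consequence (`IsDenseSubset.exists_row`): for
some strictly increasing row of `k` rationals, the set is infinite in each of the `k + 1` intervals.
The rows of the requirements at hand form a `k`-by-`k` matrix `M`. Consider the `M`-formula saying
that, however the reservoir is covered by `k` sets, for some `i` the `i`-th set has a finite subset
`E`, homogeneous of color `i`, such that the stem together with `E` makes progress: it adds an
element, or enumerates an element of `U i`, or an element of each `V i l`. By compactness this is
`Σ⁰₁` relative to the join of the reservoir and `C`, which belongs to the Scott set.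

* If the formula is essential, fairness gives a valuation that diagonalizes against `A₀`, `A₁` and
  satisfies it. The reservoir is thinned until the elements of a long initial segment have limit
  colors. These form a cover, and the resulting `E` can be added to the stem of color `i`, which
  thereby enumerates an element of the wrong set (`exists_advances_of_allBad`).
* If it is not essential, then for each of the finitely many `M`-types the Scott set contains
  a cover of the reservoir without such sets `E` (`IsScottSet.exists_avoiding`). The reservoir is
  refined to one piece of each cover. Either a piece belongs to a color with a `dense` requirement,
  and then the enumerated set is finite in some interval, or a single color with a `thin`
  requirement is responsible for all cells of the partition, and then the enumerated set is finite
  (`exists_advances_of_not_essential`).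

Computability relative to `X` is handled through the predicates enumerable relative to `X`, in
the normal form `EnumIn`. They are closed under the positive logical operations and bounded
quantification, they contain the graphs of the functions recursive in `X` (`EnumIn.graph_nat`),
and they are `Σ⁰₁` (`EnumIn.sigmaOne`).
-/

namespace ERFair

/-! ### Predicates enumerable relative to a set -/

section Enumerable

variable {α β : Type*} [Primcodable α] [Primcodable β] {X Y : Set ℕ}

@[simp]
theorem length_initialSegment (X : Set ℕ) (n : ℕ) : (initialSegment X n).length = n := by
  simp [initialSegment]

open Classical in
theorem getElem?_initialSegment (X : Set ℕ) (n j : ℕ) (h : j < n) :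
    (initialSegment X n)[j]? = some (decide (j ∈ X)) := by
  simp [initialSegment, h]

theorem take_initialSegment (X : Set ℕ) {m n : ℕ} (h : m ≤ n) :
    (initialSegment X n).take m = initialSegment X m := by
  simp [initialSegment, ← List.map_take, List.take_range, h]

theorem initialSegment_congr {n : ℕ} (h : ∀ j < n, j ∈ X ↔ j ∈ Y) :
    initialSegment X n = initialSegment Y n := by
  unfold initialSegment
  refine List.map_congr_left fun j hj => ?_
  simp [h j (List.mem_range.1 hj)]

theorem eq_initialSegment_iff (σ : List Bool) :
    σ = initialSegment X σ.length ↔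
      ∀ j ∈ List.range σ.length, (σ[j]? = some true ∧ j ∈ X) ∨ (σ[j]? = some false ∧ j ∉ X) := by
  constructor
  · intro h j hj
    have hj' := List.mem_range.1 hj
    rw [h, getElem?_initialSegment X _ j hj']
    by_cases hX : j ∈ X <;> simp [hX]
  · intro h
    apply List.ext_getElem?
    intro j
    by_cases hj : j < σ.length
    · rw [getElem?_initialSegment X _ j hj]
      rcases h j (List.mem_range.2 hj) with ⟨h1, h2⟩ | ⟨h1, h2⟩ <;> simp [h1, h2]
    · simp [hj]

/-- `φ` is recursively enumerable relative to `X`. The normal form taken as the definition: some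
initial segment of the characteristic function of `X` is a witness for `φ a`, and being a witness
is a primitive recursive relation. The length of the segment also bounds unbounded searches. -/
def EnumIn (X : Set ℕ) (φ : α → Prop) : Prop :=
  ∃ R : List Bool → α → Prop, PrimrecRel R ∧ ∀ a, φ a ↔ ∃ n, R (initialSegment X n) a

namespace EnumIn

theorem of_iff {φ ψ : α → Prop} (h : EnumIn X φ) (H : ∀ a, ψ a ↔ φ a) : EnumIn X ψ := by
  obtain ⟨R, hR, h⟩ := h
  exact ⟨R, hR, fun a => (H a).trans (h a)⟩

/-- A predicate decided by a primitive recursive relation from an initial segment of `X` of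
primitive recursively given length is enumerable relative to `X`. -/
theorem of_initialSegment {R : List Bool → α → Prop} (hR : PrimrecRel R) {g : α → ℕ}
    (hg : Primrec g) : EnumIn X fun a => R (initialSegment X (g a)) a := by
  refine ⟨fun σ a => g a ≤ σ.length ∧ R (σ.take (g a)) a, ?_, fun a => ⟨fun h => ?_, ?_⟩⟩
  · refine PrimrecPred.primrecRel (p := fun p : List Bool × α =>
      g p.2 ≤ p.1.length ∧ R (p.1.take (g p.2)) p.2) ?_
    exact (Primrec.nat_le.comp (hg.comp .snd) (Primrec.list_length.comp .fst)).and
      (hR.comp (Primrec.list_take.comp (hg.comp .snd) .fst) .snd)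
  · exact ⟨g a, by simp, by rwa [take_initialSegment X le_rfl]⟩
  · rintro ⟨n, h1, h2⟩
    rw [length_initialSegment] at h1
    rwa [take_initialSegment X h1] at h2

theorem of_primrec {φ : α → Prop} (h : PrimrecPred φ) : EnumIn X φ :=
  of_initialSegment (R := fun _ a => φ a)
    (PrimrecPred.primrecRel (p := fun p : List Bool × α => φ p.2) (h.comp .snd)) (Primrec.const 0)

theorem mem : EnumIn X fun n : ℕ => n ∈ X := by
  refine (of_initialSegment (X := X) (R := fun σ n => σ[n]? = some true) ?_ Primrec.succ).of_iff
    fun n => ?_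
  · exact Primrec.eq.comp Primrec.list_getElem? (Primrec.const _)
  · rw [getElem?_initialSegment X _ n (Nat.lt_succ_self n)]
    simp

theorem not_mem : EnumIn X fun n : ℕ => n ∉ X := by
  refine (of_initialSegment (X := X) (R := fun σ n => σ[n]? = some false) ?_ Primrec.succ).of_iff
    fun n => ?_
  · exact Primrec.eq.comp Primrec.list_getElem? (Primrec.const _)
  · rw [getElem?_initialSegment X _ n (Nat.lt_succ_self n)]
    simp

theorem comp {φ : β → Prop} (h : EnumIn X φ) {f : α → β} (hf : Primrec f) :
    EnumIn X fun a => φ (f a) := by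
  obtain ⟨R, hR, h⟩ := h
  exact ⟨fun σ a => R σ (f a), hR.comp₂ .left (hf.comp₂ .right), fun a => h (f a)⟩

/-- The witness relation can be taken closed under extension of the initial segment. -/
theorem exists_monotone {φ : α → Prop} (h : EnumIn X φ) :
    ∃ R : List Bool → α → Prop, PrimrecRel R ∧ (∀ a, φ a ↔ ∃ n, R (initialSegment X n) a) ∧
      ∀ a m n, m ≤ n → R (initialSegment X m) a → R (initialSegment X n) a := by
  obtain ⟨R, hR, h⟩ := h
  have key : ∀ a n, (∃ m ∈ List.range ((initialSegment X n).length + 1),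
      R ((initialSegment X n).take m) a) ↔
      ∃ m ≤ n, R (initialSegment X m) a := by
    intro a n
    simp only [length_initialSegment, List.mem_range, Nat.lt_succ_iff]
    refine exists_congr fun m => and_congr_right fun hm => ?_
    rw [take_initialSegment X hm]
  refine ⟨fun σ a => ∃ m ∈ List.range (σ.length + 1), R (σ.take m) a, ?_, fun a => ?_,
    fun a m n hmn => ?_⟩
  · have h1 : PrimrecRel fun (m : ℕ) (p : List Bool × α) => R (p.1.take m) p.2 :=
      hR.comp (Primrec.list_take.comp .fst (Primrec.fst.comp .snd)) (Primrec.snd.comp .snd)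
    exact h1.exists_mem_list.comp
      (Primrec.list_range.comp (Primrec.succ.comp (Primrec.list_length.comp .fst))) Primrec.id
  · simp only [key, h]
    exact ⟨fun ⟨n, hn⟩ => ⟨n, n, le_rfl, hn⟩, fun ⟨_, m, _, hm⟩ => ⟨m, hm⟩⟩
  · simp only [key]
    exact fun ⟨l, hl, hR⟩ => ⟨l, hl.trans hmn, hR⟩

theorem or {φ ψ : α → Prop} (h₁ : EnumIn X φ) (h₂ : EnumIn X ψ) :
    EnumIn X fun a => φ a ∨ ψ a := by
  obtain ⟨R, hR, h⟩ := h₁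
  obtain ⟨R', hR', h'⟩ := h₂
  refine ⟨fun σ a => R σ a ∨ R' σ a, PrimrecPred.or hR hR', fun a => ?_⟩
  simp only [h, h', exists_or]

theorem and {φ ψ : α → Prop} (h₁ : EnumIn X φ) (h₂ : EnumIn X ψ) :
    EnumIn X fun a => φ a ∧ ψ a := by
  obtain ⟨R, hR, h, hm⟩ := h₁.exists_monotone
  obtain ⟨R', hR', h', hm'⟩ := h₂.exists_monotone
  refine ⟨fun σ a => R σ a ∧ R' σ a, PrimrecPred.and hR hR', fun a => ?_⟩
  simp only [h, h']
  constructor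
  · rintro ⟨⟨n, hn⟩, n', hn'⟩
    exact ⟨max n n', hm _ _ _ (le_max_left _ _) hn, hm' _ _ _ (le_max_right _ _) hn'⟩
  · rintro ⟨n, hn, hn'⟩
    exact ⟨⟨n, hn⟩, n, hn'⟩

theorem ex {φ : α → β → Prop} (h : EnumIn X fun p : α × β => φ p.1 p.2) :
    EnumIn X fun a => ∃ b, φ a b := by
  obtain ⟨R, hR, h, hm⟩ := h.exists_monotone
  refine ⟨fun σ a => ∃ b ∈ (List.range σ.length).filterMap (Encodable.decode (α := β)),
    R σ (a, b), ?_, fun a => ?_⟩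
  · have h1 : PrimrecRel fun (b : β) (p : List Bool × α) => R p.1 (p.2, b) :=
      hR.comp (Primrec.fst.comp .snd) ((Primrec.snd.comp .snd).pair .fst)
    refine h1.exists_mem_list.comp (?_ : Primrec fun p : List Bool × α => _) Primrec.id
    exact Primrec.listFilterMap (Primrec.list_range.comp (Primrec.list_length.comp .fst))
      (Primrec.decode.comp₂ .right)
  · constructor
    · rintro ⟨b, hb⟩
      obtain ⟨n, hn⟩ := (h (a, b)).1 hb
      refine ⟨max n (Encodable.encode b + 1), b, ?_, hm _ _ _ (le_max_left _ _) hn⟩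
      simp only [List.mem_filterMap, List.mem_range, length_initialSegment]
      exact ⟨Encodable.encode b, by omega, Encodable.encodek b⟩
    · rintro ⟨n, b, -, hn⟩
      exact ⟨b, (h (a, b)).2 ⟨n, hn⟩⟩

theorem forall_mem_list {φ : α → β → Prop} (h : EnumIn X fun p : α × β => φ p.1 p.2)
    {l : α → List β} (hl : Primrec l) : EnumIn X fun a => ∀ b ∈ l a, φ a b := by
  obtain ⟨R, hR, h, hm⟩ := h.exists_monotone
  refine ⟨fun σ a => ∀ b ∈ l a, R σ (a, b), ?_, fun a => ?_⟩
  · have h1 : PrimrecRel fun (b : β) (p : List Bool × α) => R p.1 (p.2, b) :=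
      hR.comp (Primrec.fst.comp .snd) ((Primrec.snd.comp .snd).pair .fst)
    exact h1.forall_mem_list.comp (hl.comp .snd) Primrec.id
  · have h' : ∀ b, φ a b ↔ ∃ n, R (initialSegment X n) (a, b) := fun b => h (a, b)
    simp only [h']
    refine ⟨fun H => ?_, fun ⟨n, H⟩ b hb => ⟨n, H b hb⟩⟩
    generalize l a = L at H
    induction L with
    | nil => exact ⟨0, by simp⟩
    | cons b t ih =>
      obtain ⟨n, hn⟩ := ih fun c hc => H c (List.mem_cons_of_mem _ hc)
      obtain ⟨n', hn'⟩ := H b List.mem_cons_self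
      refine ⟨max n n', fun c hc => ?_⟩
      rcases List.mem_cons.1 hc with rfl | hc
      · exact hm _ _ _ (le_max_right _ _) hn'
      · exact hm _ _ _ (le_max_left _ _) (hn c hc)

theorem exists_finite {ι : Type*} [Finite ι] {φ : ι → α → Prop} (h : ∀ i, EnumIn X (φ i)) :
    EnumIn X fun a => ∃ i, φ i a := by
  classical
  have := Fintype.ofFinite ι
  have key : ∀ s : Finset ι, EnumIn X fun a => ∃ i ∈ s, φ i a := by
    intro s
    induction s using Finset.induction_on with
    | empty => exact (of_primrec (PrimrecPred.of_eq (p := fun _ => False)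
        (Primrec.eq.comp (Primrec.const 0) (Primrec.const 1) |>.of_eq (by simp))
        (by simp)))
    | insert i s _ ih => exact ((h i).or ih).of_iff fun a => by simp
  exact (key Finset.univ).of_iff fun a => by simp

theorem forall_finite {ι : Type*} [Finite ι] {φ : ι → α → Prop} (h : ∀ i, EnumIn X (φ i)) :
    EnumIn X fun a => ∀ i, φ i a := by
  classical
  have := Fintype.ofFinite ι
  have key : ∀ s : Finset ι, EnumIn X fun a => ∀ i ∈ s, φ i a := by
    intro s
    induction s using Finset.induction_on with
    | empty => exact (of_primrec (PrimrecPred.of_eq (p := fun _ => True)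
        (Primrec.eq.comp (Primrec.const 0) (Primrec.const 0) |>.of_eq (by simp))
        (by simp)))
    | insert i s _ ih => exact ((h i).and ih).of_iff fun a => by simp
  exact (key Finset.univ).of_iff fun a => by simp

/-- If membership in the sets `Z b` and in their complements is enumerable relative to `X`,
uniformly in `b`, then so is every predicate enumerable relative to `Z b`. -/
theorem of_family {Z : β → Set ℕ} (h₁ : EnumIn X fun p : β × ℕ => p.2 ∈ Z p.1)
    (h₂ : EnumIn X fun p : β × ℕ => p.2 ∉ Z p.1) {R : List Bool → α → Prop} (hR : PrimrecRel R) :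
    EnumIn X fun p : β × α => ∃ n, R (initialSegment (Z p.1) n) p.2 := by
  have hbit : ∀ c : Bool, PrimrecPred fun q : ((β × α) × List Bool) × ℕ => q.1.2[q.2]? = some c :=
    fun c => Primrec.eq.comp
      (Primrec.list_getElem?.comp (Primrec.snd.comp .fst) .snd) (Primrec.const _)
  have hpair : Primrec fun q : ((β × α) × List Bool) × ℕ => (q.1.1.1, q.2) :=
    ((Primrec.fst.comp .fst).comp .fst).pair .snd
  have hseg : EnumIn X fun q : (β × α) × List Bool => ∀ j ∈ List.range q.2.length,
      (q.2[j]? = some true ∧ j ∈ Z q.1.1) ∨ (q.2[j]? = some false ∧ j ∉ Z q.1.1) :=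
    forall_mem_list (φ := fun (q : (β × α) × List Bool) (j : ℕ) =>
      (q.2[j]? = some true ∧ j ∈ Z q.1.1) ∨ (q.2[j]? = some false ∧ j ∉ Z q.1.1))
      (((of_primrec (hbit true)).and (h₁.comp hpair)).or
        ((of_primrec (hbit false)).and (h₂.comp hpair)))
      (Primrec.list_range.comp (Primrec.list_length.comp .snd))
  have hR' : EnumIn X fun q : (β × α) × List Bool => R q.2 q.1.2 :=
    of_primrec (hR.comp .snd (Primrec.snd.comp .fst))
  refine (ex (φ := fun (p : β × α) (σ : List Bool) => (∀ j ∈ List.range σ.length,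
      (σ[j]? = some true ∧ j ∈ Z p.1) ∨ (σ[j]? = some false ∧ j ∉ Z p.1)) ∧ R σ p.2)
      (hseg.and hR')).of_iff fun p => ?_
  simp only [← eq_initialSegment_iff]
  constructor
  · rintro ⟨n, hn⟩
    exact ⟨_, by simp, hn⟩
  · rintro ⟨σ, h1, h2⟩
    exact ⟨σ.length, h1 ▸ h2⟩

/-- Transitivity: what is enumerable relative to `Y` is enumerable relative to any set relative to
which `Y` and its complement are enumerable. -/
theorem trans {φ : α → Prop} (h : EnumIn Y φ) (h₁ : EnumIn X (· ∈ Y)) (h₂ : EnumIn X (· ∉ Y)) :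
    EnumIn X φ := by
  obtain ⟨R, hR, h⟩ := h
  exact ((of_family (β := Unit) (Z := fun _ => Y) (h₁.comp .snd) (h₂.comp .snd) hR).comp
    ((Primrec.const ()).pair Primrec.id)).of_iff h

end EnumIn

end Enumerable

/-! ### Oracle computations and enumerability -/

section Oracle

variable {X Y : Set ℕ}

/-- `m` is a value of the recursion of length `n` if and only if there is a list of the
intermediate values. -/
theorem mem_natRec_iff (f : Part ℕ) (g : ℕ → ℕ →. ℕ) (n m : ℕ) :
    m ∈ (Nat.rec f (fun y ih => ih.bind fun i => g y i) n : Part ℕ) ↔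
      ∃ l : List ℕ, ((∃ b, l[0]? = some b ∧ b ∈ f) ∧ l[n]? = some m) ∧
        ∀ y ∈ List.range n, ∃ i j, (l[y]? = some i ∧ l[y + 1]? = some j) ∧ j ∈ g y i := by
  induction n generalizing m with
  | zero =>
    constructor
    · intro h
      exact ⟨[m], ⟨⟨m, rfl, h⟩, rfl⟩, by simp⟩
    · rintro ⟨l, ⟨⟨b, h1, h2⟩, h3⟩, -⟩
      obtain rfl : b = m := by simpa [h1] using h3
      exact h2
  | succ n ih =>
    simp only [Part.mem_bind_iff, ih]
    constructor
    · rintro ⟨i, ⟨l, ⟨⟨b, h1, h2⟩, h3⟩, h4⟩, h5⟩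
      have hn : n < l.length := (List.getElem?_eq_some_iff.1 h3).1
      have htake : ∀ j ≤ n, (l.take (n + 1) ++ [m])[j]? = l[j]? := by
        intro j hj
        rw [List.getElem?_append_left (by simp; omega), List.getElem?_take, if_pos (by omega)]
      have hlast : (l.take (n + 1) ++ [m])[n + 1]? = some m := by
        rw [List.getElem?_append_right (by simp)]
        have : n + 1 - (l.take (n + 1)).length = 0 := by simp; omega
        rw [this]; rfl
      refine ⟨l.take (n + 1) ++ [m], ⟨⟨b, ?_, h2⟩, hlast⟩, fun y hy => ?_⟩
      · rw [htake 0 (Nat.zero_le _), h1]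
      · rcases Nat.lt_succ_iff_lt_or_eq.1 (List.mem_range.1 hy) with hy | rfl
        · obtain ⟨i', j', ⟨e1, e2⟩, e3⟩ := h4 y (List.mem_range.2 hy)
          exact ⟨i', j', ⟨by rw [htake y hy.le, e1], by rw [htake (y + 1) hy, e2]⟩, e3⟩
        · exact ⟨i, m, ⟨by rw [htake y le_rfl, h3], hlast⟩, h5⟩
    · rintro ⟨l, ⟨⟨b, h1, h2⟩, h3⟩, h4⟩
      obtain ⟨i, j, ⟨e1, e2⟩, e3⟩ := h4 n (List.mem_range.2 (Nat.lt_succ_self n))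
      obtain rfl : j = m := by simpa [e2] using h3
      exact ⟨i, ⟨l, ⟨⟨b, h1, h2⟩, e1⟩, fun y hy =>
        h4 y (List.mem_range.2 ((List.mem_range.1 hy).trans (Nat.lt_succ_self n)))⟩, e3⟩

theorem mem_charFun {n m : ℕ} : m ∈ charFun X n ↔ (n ∈ X ∧ m = 1) ∨ (n ∉ X ∧ m = 0) := by
  unfold charFun
  by_cases h : n ∈ X <;> simp [h]

/-- The graph of a function recursive in `X` is enumerable relative to `X`. -/
theorem EnumIn.graph_nat {f : ℕ →. ℕ} (hf : Nat.RecursiveIn {charFun X} f) :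
    EnumIn X fun p : ℕ × ℕ => p.2 ∈ f p.1 := by
  have tot : ∀ {g : ℕ → ℕ}, Primrec g → EnumIn X fun p : ℕ × ℕ => p.2 ∈ (g : ℕ →. ℕ) p.1 :=
    fun hg => (of_primrec (Primrec.eq.comp Primrec.snd (hg.comp .fst))).of_iff fun p => by
      simp [PFun.coe_val]
  induction hf with
  | zero => exact tot (Primrec.const 0)
  | succ => exact tot Primrec.succ
  | left => exact tot (Primrec.fst.comp Primrec.unpair)
  | right => exact tot (Primrec.snd.comp Primrec.unpair)
  | oracle g hg =>
    obtain rfl := hg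
    refine (((EnumIn.mem.comp .fst).and (of_primrec (Primrec.eq.comp .snd (.const 1)))).or
      ((EnumIn.not_mem.comp .fst).and (of_primrec (Primrec.eq.comp .snd (.const 0))))).of_iff
      fun p => mem_charFun
  | @pair f h _ _ ihf ihh =>
    have h1 := (ihf.comp (f := fun p : ℕ × ℕ => (p.1, p.2.unpair.1))
      (Primrec.fst.pair (Primrec.fst.comp (Primrec.unpair.comp .snd)))).and
      (ihh.comp (f := fun p : ℕ × ℕ => (p.1, p.2.unpair.2))
      (Primrec.fst.pair (Primrec.snd.comp (Primrec.unpair.comp .snd))))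
    refine h1.of_iff fun p => ?_
    simp only [Seq.seq, Part.map_eq_map, Part.mem_bind_iff, Part.mem_map_iff]
    constructor
    · rintro ⟨_, ⟨a, ha, rfl⟩, b, hb, h⟩
      rw [← h]; simpa using ⟨ha, hb⟩
    · rintro ⟨ha, hb⟩
      exact ⟨_, ⟨_, ha, rfl⟩, _, hb, by simp⟩
  | @comp f h _ _ ihf ihh =>
    refine (ex (φ := fun (p : ℕ × ℕ) b => b ∈ h p.1 ∧ p.2 ∈ f b)
      ((ihh.comp (f := fun q : (ℕ × ℕ) × ℕ => (q.1.1, q.2))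
        ((Primrec.fst.comp .fst).pair .snd)).and
      (ihf.comp (f := fun q : (ℕ × ℕ) × ℕ => (q.2, q.1.2))
        (Primrec.snd.pair (Primrec.snd.comp .fst))))).of_iff fun p => Part.mem_bind_iff
  | @prec f h _ _ ihf ihh =>
    have ha : Primrec fun p : ℕ × ℕ => p.1.unpair.1 :=
      Primrec.fst.comp (Primrec.unpair.comp .fst)
    have hn : Primrec fun p : ℕ × ℕ => p.1.unpair.2 :=
      Primrec.snd.comp (Primrec.unpair.comp .fst)
    refine (ex (φ := fun (p : ℕ × ℕ) (l : List ℕ) =>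
      ((∃ b, l[0]? = some b ∧ b ∈ f p.1.unpair.1) ∧ l[p.1.unpair.2]? = some p.2) ∧
        ∀ y ∈ List.range p.1.unpair.2, ∃ i j, (l[y]? = some i ∧ l[y + 1]? = some j) ∧
          j ∈ h (Nat.pair p.1.unpair.1 (Nat.pair y i))) (.and (.and ?_ ?_) ?_)).of_iff
      fun p => mem_natRec_iff _ (fun y i => h (Nat.pair p.1.unpair.1 (Nat.pair y i))) _ _
    · refine ex (φ := fun (q : (ℕ × ℕ) × List ℕ) b => q.2[0]? = some b ∧ b ∈ f q.1.1.unpair.1)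
        ((of_primrec ?_).and (ihf.comp (f := fun r : ((ℕ × ℕ) × List ℕ) × ℕ =>
          (r.1.1.1.unpair.1, r.2)) ((ha.comp (Primrec.fst.comp .fst)).pair .snd)))
      exact Primrec.eq.comp (Primrec.list_getElem?.comp (Primrec.snd.comp .fst) (.const 0))
        (Primrec.option_some.comp .snd)
    · exact of_primrec (Primrec.eq.comp (Primrec.list_getElem?.comp .snd (hn.comp .fst))
        (Primrec.option_some.comp (Primrec.snd.comp .fst)))
    · refine forall_mem_list (φ := fun (q : (ℕ × ℕ) × List ℕ) y => ∃ i j,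
        (q.2[y]? = some i ∧ q.2[y + 1]? = some j) ∧
          j ∈ h (Nat.pair q.1.1.unpair.1 (Nat.pair y i))) ?_
        (Primrec.list_range.comp (hn.comp .fst))
      refine ex (φ := fun (r : ((ℕ × ℕ) × List ℕ) × ℕ) i => ∃ j,
        (r.1.2[r.2]? = some i ∧ r.1.2[r.2 + 1]? = some j) ∧
          j ∈ h (Nat.pair r.1.1.1.unpair.1 (Nat.pair r.2 i))) ?_
      refine ex (φ := fun (s : (((ℕ × ℕ) × List ℕ) × ℕ) × ℕ) j =>
        (s.1.1.2[s.1.2]? = some s.2 ∧ s.1.1.2[s.1.2 + 1]? = some j) ∧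
          j ∈ h (Nat.pair s.1.1.1.1.unpair.1 (Nat.pair s.1.2 s.2))) ?_
      have e1 : Primrec fun t : ((((ℕ × ℕ) × List ℕ) × ℕ) × ℕ) × ℕ => t.1.1 := Primrec.fst.comp .fst
      have e2 : Primrec fun t : ((((ℕ × ℕ) × List ℕ) × ℕ) × ℕ) × ℕ => t.1.2 := Primrec.snd.comp .fst
      refine .and (of_primrec (.and ?_ ?_)) (ihh.comp
        (f := fun t : ((((ℕ × ℕ) × List ℕ) × ℕ) × ℕ) × ℕ =>
          (Nat.pair t.1.1.1.1.1.unpair.1 (Nat.pair t.1.1.2 t.1.2), t.2)) (.pair ?_ .snd))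
      · exact Primrec.eq.comp (Primrec.list_getElem?.comp (Primrec.snd.comp (Primrec.fst.comp e1))
          (Primrec.snd.comp e1)) (Primrec.option_some.comp e2)
      · exact Primrec.eq.comp (Primrec.list_getElem?.comp (Primrec.snd.comp (Primrec.fst.comp e1))
          (Primrec.succ.comp (Primrec.snd.comp e1))) (Primrec.option_some.comp .snd)
      · exact Primrec₂.natPair.comp (ha.comp (Primrec.fst.comp (Primrec.fst.comp e1)))
          (Primrec₂.natPair.comp (Primrec.snd.comp e1) e2)
  | @rfind f _ ih =>
    have hpos : EnumIn X fun q : (ℕ × ℕ) × ℕ => ∃ v, v ≠ 0 ∧ v ∈ f (Nat.pair q.1.1 q.2) :=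
      ex (φ := fun (q : (ℕ × ℕ) × ℕ) v => v ≠ 0 ∧ v ∈ f (Nat.pair q.1.1 q.2))
        ((of_primrec (Primrec.eq.comp .snd (.const 0)).not).and
          (ih.comp (f := fun r : ((ℕ × ℕ) × ℕ) × ℕ => (Nat.pair r.1.1.1 r.1.2, r.2))
            ((Primrec₂.natPair.comp (Primrec.fst.comp (Primrec.fst.comp .fst))
              (Primrec.snd.comp .fst)).pair .snd)))
    have hzero : EnumIn X fun p : ℕ × ℕ => 0 ∈ f (Nat.pair p.1 p.2) :=
      ih.comp (f := fun p : ℕ × ℕ => (Nat.pair p.1 p.2, 0))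
        ((Primrec₂.natPair.comp .fst .snd).pair (.const 0))
    refine (hzero.and (forall_mem_list (φ := fun (p : ℕ × ℕ) i =>
      ∃ v, v ≠ 0 ∧ v ∈ f (Nat.pair p.1 i)) hpos (Primrec.list_range.comp .snd))).of_iff
      fun p => Nat.mem_rfind.trans ?_
    simp only [Part.map_eq_map, Part.mem_map_iff, decide_eq_true_eq,
      decide_eq_false_iff_not, List.mem_range]
    refine and_congr ⟨?_, fun h => ⟨0, h, rfl⟩⟩
      (forall₂_congr fun i _ => exists_congr fun v => and_comm)
    rintro ⟨v, hv, rfl⟩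
    exact hv

theorem EnumIn.graph {α β : Type*} [Primcodable α] [Primcodable β] {f : α →. β}
    (hf : RecursiveIn {charFun X} f) : EnumIn X fun p : α × β => p.2 ∈ f p.1 := by
  refine ((EnumIn.graph_nat hf).comp (f := fun p : α × β =>
    (Encodable.encode p.1, Encodable.encode p.2))
    ((Primrec.encode.comp .fst).pair (Primrec.encode.comp .snd))).of_iff fun p => ?_
  simp [Part.mem_map_iff, Encodable.encode_inj]

theorem SetReducible.enumIn_mem (h : SetReducible Y X) : EnumIn X (· ∈ Y) :=
  ((EnumIn.graph h).comp (f := fun n : ℕ => (n, 1)) (Primrec.id.pair (.const 1))).of_iff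
    fun n => by simp [mem_charFun]

/-- The sequence of initial segments of `X` is computable from `X`. -/
theorem recursiveIn_initialSegment (X : Set ℕ) :
    Nat.RecursiveIn {charFun X} fun n => Part.some (Encodable.encode (initialSegment X n)) := by
  classical
  -- One step of the recursion, on the number `⟨bit, ⟨a, ⟨y, code⟩⟩⟩`: append the bit to the string.
  let step : ℕ → ℕ := fun q => Encodable.encode
    ((Encodable.decode (α := List Bool) q.unpair.2.unpair.2.unpair.2).getD [] ++
      [decide (q.unpair.1 = 1)])
  have hstep : Nat.Primrec step := by
    refine Primrec.nat_iff.1 (Primrec.encode.comp (Primrec.list_append.comp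
      (Primrec.option_getD.comp (Primrec.decode.comp ?_) (Primrec.const []))
      (Primrec.list_cons.comp ?_ (Primrec.const []))))
    · exact Primrec.snd.comp (Primrec.unpair.comp (Primrec.snd.comp (Primrec.unpair.comp
        (Primrec.snd.comp Primrec.unpair))))
    · exact (Primrec.eq.comp (Primrec.fst.comp Primrec.unpair) (Primrec.const 1)).decide
  have hbit : Nat.RecursiveIn {charFun X} fun p => charFun X p.unpair.2.unpair.1 := by
    refine ((Nat.RecursiveIn.oracle _ (Set.mem_singleton (charFun X))).comp (Nat.Primrec.recursiveIn
      (Primrec.nat_iff.1 (Primrec.fst.comp (Primrec.unpair.comp (Primrec.snd.comp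
        Primrec.unpair)))))).of_eq fun n => ?_
    exact Part.bind_some _ _
  have hid : Nat.RecursiveIn {charFun X} fun p : ℕ => Part.some p :=
    Nat.Primrec.recursiveIn (Primrec.nat_iff.1 Primrec.id)
  have hrec := Nat.RecursiveIn.prec
    (Nat.Primrec.recursiveIn (O := {charFun X}) (Primrec.nat_iff.1
      (Primrec.const (Encodable.encode ([] : List Bool)))))
    ((Nat.Primrec.recursiveIn hstep).comp (hbit.pair hid))
  refine (hrec.comp (Nat.Primrec.recursiveIn (Primrec.nat_iff.1
    (Primrec₂.natPair.comp (Primrec.const 0) Primrec.id)))).of_eq fun n => ?_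
  have hX : ∀ y, charFun X y = Part.some (if y ∈ X then 1 else 0) := fun _ => rfl
  simp only [Part.coe_some, Part.bind_eq_bind, Part.bind_some, Nat.unpair_pair, id, hX, Seq.seq,
    Part.map_eq_map, Part.map_some]
  induction n with
  | zero => simp [initialSegment]
  | succ n ih =>
    have hs : initialSegment X (n + 1) = initialSegment X n ++ [decide (n ∈ X)] := by
      simp [initialSegment, List.range_succ]
    simp only [ih, Part.bind_some]
    simp only [Nat.unpair_pair, step, Encodable.encodek, hs, Option.getD_some]
    by_cases hn : n ∈ X <;> simp [hn]

/-- Unbounded search for an initial segment of `X` with a primitive recursive property. -/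
theorem recursiveIn_search {Q : List Bool → ℕ → Prop} (hQ : PrimrecRel Q) {h : List Bool → ℕ → ℕ}
    (hh : Primrec₂ h) [DecidableRel Q] :
    Nat.RecursiveIn {charFun X} fun a =>
      (Nat.rfind fun n => Part.some (decide (Q (initialSegment X n) a))).map
        fun n => h (initialSegment X n) a := by
  let dec : ℕ → List Bool := fun s => (Encodable.decode (α := List Bool) s).getD []
  have hdec : Primrec dec := Primrec.option_getD.comp Primrec.decode (Primrec.const [])
  have hdec' : ∀ σ, dec (Encodable.encode σ) = σ := fun σ => by simp [dec]
  let t : ℕ → ℕ := fun p => if Q (dec p.unpair.1) p.unpair.2 then 0 else 1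
  have ht : Nat.Primrec t := Primrec.nat_iff.1 (Primrec.ite
    (hQ.comp (hdec.comp (Primrec.fst.comp Primrec.unpair)) (Primrec.snd.comp Primrec.unpair))
    (.const 0) (.const 1))
  let u : ℕ → ℕ := fun p => h (dec p.unpair.1) p.unpair.2
  have hu : Nat.Primrec u := Primrec.nat_iff.1
    (hh.comp (hdec.comp (Primrec.fst.comp Primrec.unpair)) (Primrec.snd.comp Primrec.unpair))
  have hseg : Nat.RecursiveIn {charFun X} fun p =>
      Part.some (Nat.pair (Encodable.encode (initialSegment X p.unpair.2)) p.unpair.1) := by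
    refine (((recursiveIn_initialSegment X).comp .right).pair .left).of_eq fun p => ?_
    simp [Seq.seq]
  have hfind := Nat.RecursiveIn.rfind ((Nat.Primrec.recursiveIn ht).comp hseg)
  have hid : Nat.RecursiveIn {charFun X} fun p : ℕ => Part.some p :=
    Nat.Primrec.recursiveIn (Primrec.nat_iff.1 Primrec.id)
  refine ((Nat.Primrec.recursiveIn hu).comp (hseg.comp (hid.pair hfind))).of_eq fun a => ?_
  have hdecide : ∀ n, decide ((if Q (initialSegment X n) a then 0 else 1) = 0) =
      decide (Q (initialSegment X n) a) := fun n => by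
    by_cases hq : Q (initialSegment X n) a <;> simp [hq]
  simp only [Part.coe_some, Part.bind_eq_bind, Part.bind_some, Nat.unpair_pair, Seq.seq,
    Part.map_eq_map, Part.map_some, t, u, hdec', Part.bind_some_eq_map, hdecide, Part.map_map,
    Function.comp_def]

theorem mem_rfind_find {P : ℕ → Prop} [DecidablePred P] (h : ∃ n, P n) :
    Nat.find h ∈ Nat.rfind fun n => Part.some (decide (P n)) := by
  refine Nat.mem_rfind.2 ⟨?_, fun {l} hl => ?_⟩
  · exact Part.mem_some_iff.2 (decide_eq_true (Nat.find_spec h)).symm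
  · exact Part.mem_some_iff.2 (decide_eq_false (Nat.find_min h hl)).symm

theorem EnumIn.sigmaOne {α : Type} [Primcodable α] {φ : α → Prop} (h : EnumIn X φ) :
    SigmaOne X φ := by
  classical
  obtain ⟨R, hR, h⟩ := h
  have hQ : PrimrecRel fun (σ : List Bool) (n : ℕ) =>
      ∃ a ∈ (Encodable.decode (α := α) n).toList, R σ a := by
    have : PrimrecRel fun (a : α) (σ : List Bool) => R σ a := hR.comp .snd .fst
    exact this.exists_mem_list.comp (Primrec.optionToList.comp (Primrec.decode.comp .snd)) .fst
  refine (recursiveIn_search (X := X) hQ (h := fun _ _ => 0) (Primrec.const 0)).of_eq fun n => ?_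
  ext m
  simp only [Part.mem_map_iff, Part.mem_bind_iff, Part.mem_coe, Part.mem_assert_iff]
  constructor
  · rintro ⟨l, hl, rfl⟩
    have h1' := of_decide_eq_true (Part.mem_some_iff.1 (Nat.mem_rfind.1 hl).1).symm
    obtain ⟨a, ha, hRa⟩ := h1'
    refine ⟨a, Option.mem_toList.1 ha, (), ⟨(h a).2 ⟨l, hRa⟩, Part.mem_some _⟩, rfl⟩
  · rintro ⟨a, ha, _, ⟨hφ, -⟩, rfl⟩
    have hex : ∃ l, ∃ a ∈ (Encodable.decode (α := α) n).toList, R (initialSegment X l) a := by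
      obtain ⟨l, hl⟩ := (h a).1 hφ
      exact ⟨l, a, Option.mem_toList.2 ha, hl⟩
    exact ⟨Nat.find hex, mem_rfind_find hex, rfl⟩

/-- Post's theorem: a set that is enumerable relative to `X` together with its complement is
computable from `X`. -/
theorem setReducible_of_enumIn (h₁ : EnumIn X (· ∈ Y)) (h₂ : EnumIn X (· ∉ Y)) :
    SetReducible Y X := by
  classical
  obtain ⟨R, hR, h⟩ := h₁
  obtain ⟨R', hR', h'⟩ := h₂
  refine RecursiveIn.iff_nat.2 ?_
  refine (recursiveIn_search (X := X) (Q := fun σ n => R σ n ∨ R' σ n) (PrimrecPred.or hR hR')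
    (h := fun σ n => if R σ n then 1 else 0)
    (Primrec.ite hR (.const 1) (.const 0))).of_eq fun n => ?_
  have hex : ∃ l, R (initialSegment X l) n ∨ R' (initialSegment X l) n := by
    by_cases hn : n ∈ Y
    · exact ((h n).1 hn).imp fun _ => Or.inl
    · exact ((h' n).1 hn).imp fun _ => Or.inr
  refine Part.eq_some_iff.2 ((Part.mem_map_iff _).2 ⟨Nat.find hex, mem_rfind_find hex, ?_⟩)
  have hR : R (initialSegment X (Nat.find hex)) n ↔ n ∈ Y := by
    refine ⟨fun hR => (h n).2 ⟨_, hR⟩, fun hn => (Nat.find_spec hex).resolve_right fun hR => ?_⟩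
    exact (h' n).2 ⟨_, hR⟩ hn
  simp [hR]

end Oracle

/-! ### Closure properties of Scott sets -/

section Scott

variable {X Y Z : Set ℕ} {α : Type*} [Primcodable α]

@[simp]
theorem two_mul_mem_join {n : ℕ} : 2 * n ∈ join X Y ↔ n ∈ X := by
  simp only [join, Set.mem_union, Set.mem_ofPred_eq]
  constructor
  · rintro (⟨m, hm, h⟩ | ⟨m, hm, h⟩)
    · obtain rfl : n = m := by omega
      exact hm
    · omega
  · exact fun h => Or.inl ⟨n, h, rfl⟩

@[simp]
theorem two_mul_add_one_mem_join {n : ℕ} : 2 * n + 1 ∈ join X Y ↔ n ∈ Y := by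
  simp only [join, Set.mem_union, Set.mem_ofPred_eq]
  constructor
  · rintro (⟨m, hm, h⟩ | ⟨m, hm, h⟩)
    · omega
    · obtain rfl : n = m := by omega
      exact hm
  · exact fun h => Or.inr ⟨n, h, rfl⟩

theorem mem_join_iff {j : ℕ} :
    j ∈ join X Y ↔ (j % 2 = 0 ∧ j / 2 ∈ X) ∨ (j % 2 = 1 ∧ j / 2 ∈ Y) := by
  rcases Nat.even_or_odd' j with ⟨n, rfl | rfl⟩
  · have h1 : 2 * n % 2 = 0 := by omega
    have h2 : 2 * n / 2 = n := by omega
    simp [h1]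
  · have h1 : (2 * n + 1) % 2 = 1 := by omega
    have h2 : (2 * n + 1) / 2 = n := by omega
    simp [h1, h2]

theorem not_mem_join_iff {j : ℕ} :
    j ∉ join X Y ↔ (j % 2 = 0 ∧ j / 2 ∉ X) ∨ (j % 2 = 1 ∧ j / 2 ∉ Y) := by
  rw [mem_join_iff]
  rcases Nat.mod_two_eq_zero_or_one j with h | h <;> simp [h]

theorem EnumIn.join_left {φ : α → Prop} (h : EnumIn X φ) : EnumIn (join X Y) φ :=
  h.trans ((EnumIn.mem.comp Primrec.nat_double).of_iff fun _ => two_mul_mem_join.symm)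
    ((EnumIn.not_mem.comp Primrec.nat_double).of_iff fun _ => two_mul_mem_join.symm.not)

theorem EnumIn.join_right {φ : α → Prop} (h : EnumIn Y φ) : EnumIn (join X Y) φ :=
  h.trans ((EnumIn.mem.comp Primrec.nat_double_succ).of_iff
      fun _ => two_mul_add_one_mem_join.symm)
    ((EnumIn.not_mem.comp Primrec.nat_double_succ).of_iff
      fun _ => two_mul_add_one_mem_join.symm.not)

/-- A set of strings is computable from `X`, through the codes of its elements, when it and its
complement are enumerable relative to `X`. -/
theorem setReducible_image_encode {T : Set α} (h₁ : EnumIn X (· ∈ T)) (h₂ : EnumIn X (· ∉ T)) :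
    SetReducible ((Encodable.encode : α → ℕ) '' T) X := by
  have hgraph : PrimrecPred fun p : ℕ × α => Encodable.encode p.2 = p.1 :=
    Primrec.eq.comp (Primrec.encode.comp .snd) .fst
  have hnone : PrimrecPred fun n : ℕ => Encodable.decode₂ α n = none :=
    Primrec.eq.comp Primrec.decode₂ (.const none)
  refine setReducible_of_enumIn ?_ ?_
  · refine (EnumIn.ex (φ := fun (n : ℕ) (a : α) => Encodable.encode a = n ∧ a ∈ T)
      ((EnumIn.of_primrec hgraph).and (h₁.comp .snd))).of_iff fun n => ?_
    simp only [Set.mem_image, and_comm]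
  · refine ((EnumIn.of_primrec hnone).or (EnumIn.ex
      (φ := fun (n : ℕ) (a : α) => Encodable.encode a = n ∧ a ∉ T)
      ((EnumIn.of_primrec hgraph).and (h₂.comp .snd)))).of_iff fun n => ?_
    constructor
    · intro hn
      rcases h : Encodable.decode₂ α n with _ | a
      · exact Or.inl rfl
      · have ha : Encodable.encode a = n := Encodable.mem_decode₂.1 h
        exact Or.inr ⟨a, ha, fun haT => hn ⟨a, haT, ha⟩⟩
    · rintro (h | ⟨a, rfl, ha⟩) ⟨b, hb, hab⟩
      · rw [← hab, Encodable.encodek₂] at h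
        exact absurd h (by simp)
      · exact ha (Encodable.encode_injective hab ▸ hb)

variable {𝒮 : Set (Set ℕ)}

theorem IsScottSet.mem_of_enumIn (h𝒮 : IsScottSet 𝒮) (hX : X ∈ 𝒮) (h₁ : EnumIn X (· ∈ Y))
    (h₂ : EnumIn X (· ∉ Y)) : Y ∈ 𝒮 :=
  h𝒮.downward X hX Y (setReducible_of_enumIn h₁ h₂)

theorem IsScottSet.inter_mem (h𝒮 : IsScottSet 𝒮) (hX : X ∈ 𝒮) (hY : Y ∈ 𝒮) : X ∩ Y ∈ 𝒮 := by
  refine h𝒮.mem_of_enumIn (h𝒮.join_mem X hX Y hY) (EnumIn.mem.join_left.and EnumIn.mem.join_right)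
    ((EnumIn.not_mem.join_left.or EnumIn.not_mem.join_right).of_iff fun n => ?_)
  rw [Set.mem_inter_iff, not_and_or]

theorem IsScottSet.mem_of_primrecPred (h𝒮 : IsScottSet 𝒮) (hX : X ∈ 𝒮) (hY : PrimrecPred (· ∈ Y)) :
    Y ∈ 𝒮 :=
  h𝒮.mem_of_enumIn hX (EnumIn.of_primrec hY) (EnumIn.of_primrec hY.not)

/-- The basis property of Scott sets for co-enumerable classes: if the enumerable set `B` of
strings leaves, at each length, a string without a prefix in `B`, then some member of the Scott
set has no initial segment in `B`. The tree in question consists of the strings `σ` none of whose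
prefixes is enumerated into `B` within `|σ|` steps. -/
theorem IsScottSet.exists_avoiding (h𝒮 : IsScottSet 𝒮) (hX : X ∈ 𝒮) {B : List Bool → Prop}
    (hB : EnumIn X B) (hne : ∀ N, ∃ σ : List Bool, σ.length = N ∧ ∀ τ, τ <+: σ → ¬ B τ) :
    ∃ P ∈ 𝒮, ∀ n, ¬ B (initialSegment P n) := by
  obtain ⟨R, hR, hBR, hm⟩ := hB.exists_monotone
  let Q : List Bool → List Bool → Prop := fun υ σ =>
    ∀ m ∈ List.range (σ.length + 1), ¬ R υ (σ.take m)
  have hQ : PrimrecRel Q := by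
    have h1 : PrimrecRel fun (m : ℕ) (p : List Bool × List Bool) => ¬ R p.1 (p.2.take m) :=
      PrimrecPred.not (hR.comp (Primrec.fst.comp .snd)
        (Primrec.list_take.comp .fst (Primrec.snd.comp .snd)))
    exact h1.forall_mem_list.comp (Primrec.list_range.comp
      (Primrec.succ.comp (Primrec.list_length.comp .snd))) Primrec.id
  let T : Set (List Bool) := {σ | Q (initialSegment X σ.length) σ}
  have hT : ∀ σ, σ ∈ T ↔ ∀ τ, τ <+: σ → ¬ R (initialSegment X σ.length) τ := by
    intro σ
    change (∀ m ∈ List.range (σ.length + 1), ¬ R (initialSegment X σ.length) (σ.take m)) ↔ _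
    constructor
    · intro h τ hτ
      rw [List.prefix_iff_eq_take.1 hτ]
      exact h _ (List.mem_range.2 (Nat.lt_succ_of_le hτ.length_le))
    · exact fun h m _ => h _ (List.take_prefix m σ)
  have htree : IsBinaryTree T := by
    intro σ hσ τ hτ
    rw [hT] at hσ ⊢
    exact fun υ hυ hRυ => hσ υ (hυ.trans hτ) (hm _ _ _ hτ.length_le hRυ)
  have hinf : T.Infinite := by
    refine Set.infinite_of_injective_forall_mem (f := fun N => (hne N).choose) ?_ fun N => ?_
    · intro N N' h
      have h' := congrArg List.length h
      simpa only [(hne N).choose_spec.1, (hne N').choose_spec.1] using h'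
    · rw [hT]
      exact fun τ hτ hRτ => (hne N).choose_spec.2 τ hτ ((hBR τ).2 ⟨_, hRτ⟩)
  have hmem : (Encodable.encode : List Bool → ℕ) '' T ∈ 𝒮 :=
    h𝒮.downward X hX _ (setReducible_image_encode
      (EnumIn.of_initialSegment hQ Primrec.list_length)
      (EnumIn.of_initialSegment hQ.not Primrec.list_length))
  obtain ⟨P, hP, hpath⟩ := h𝒮.path_mem T htree hinf hmem
  refine ⟨P, hP, fun n hn => ?_⟩
  obtain ⟨s, hs⟩ := (hBR _).1 hn
  have hpre : initialSegment P n <+: initialSegment P (max n s) := by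
    rw [← take_initialSegment P (le_max_left n s)]
    exact List.take_prefix _ _
  refine (hT _).1 (hpath (max n s)) _ hpre ?_
  rw [length_initialSegment]
  exact hm _ _ _ (le_max_right _ _) hs

theorem exists_infinite_inter {ι : Type*} [Finite ι] (hX : X.Infinite) {Z : ι → Set ℕ}
    (h : ∀ x ∈ X, ∃ i, x ∈ Z i) : ∃ i, (X ∩ Z i).Infinite := by
  by_contra! hfin
  refine hX ((Set.finite_iUnion fun i => hfin i).subset fun x hx => ?_)
  obtain ⟨i, hi⟩ := h x hx
  exact Set.mem_iUnion.2 ⟨i, hx, hi⟩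

end Scott

/-! ### Requirements and the strings that meet them -/

/-- An enumeration operator, given by the primitive recursive relation between the strings and
the numbers enumerated on their account. -/
abbrev EnumOperator : Type := {R : List Bool → ℕ → Prop // PrimrecRel R}

/-- The set enumerated by an operator from an oracle. -/
def EnumOperator.apply (e : EnumOperator) (X : Set ℕ) : Set ℕ :=
  {a | ∃ n, e.1 (initialSegment X n) a}

/-- What a homogeneous set `G` of one color may be required to satisfy:
`grow` asks `G` to be infinite,
`thin e` asks that `e (G ⊕ C)` is not an infinite set of names of elements of `A₀`, and
`dense e x` asks that `e (G ⊕ C)` is not a set of names of elements of `A₁` that has infinitely many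
elements in each of the open intervals determined by `x`. -/
inductive Requirement (k : ℕ) : Type
  | grow : Requirement k
  | thin (e : EnumOperator) : Requirement k
  | dense (e : EnumOperator) (x : Fin k → ℚ) (hx : StrictMono x) : Requirement k

section Strings

variable {k : ℕ} {α : Type*} [Primcodable α]

/-- The finite set `F ∪ E` makes progress on a requirement: it adds an element, or it enumerates an
element of `U`, or an element of each `V l`. -/
def Achieves (C : Set ℕ) (F : Finset ℕ) (E : List ℕ) (U : Set ℕ) (V : Fin (k + 1) → Set ℕ) :
    Requirement k → Prop
  | .grow => E ≠ []
  | .thin e => ∃ a, a ∈ U ∧ a ∈ e.apply (join (F ∪ {x | x ∈ E}) C)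
  | .dense e _ _ => ∀ l, ∃ a, a ∈ V l ∧ a ∈ e.apply (join (F ∪ {x | x ∈ E}) C)

/-- A string `σ` stands for the sets `{x | σ (x * k + i) = 1}`, `i < k`, which are meant to cover
`X`. It is *bad* if some `x ∈ X` is visibly not covered, or if for some color `i` there is
a finite subset `E` of the `i`-th set that is homogeneous of color `i` and makes progress on the
requirement `τ i`. -/
def IsBad (f : ℕ → ℕ → Fin k) (C X : Set ℕ) (F : Fin k → Finset ℕ) (τ : Fin k → Requirement k)
    (U : Fin k → Set ℕ) (V : Fin k → Fin (k + 1) → Set ℕ) (σ : List Bool) : Prop :=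
  (∃ x, x ∈ X ∧ ∀ i : Fin k, σ[x * k + i]? = some false) ∨
    ∃ i : Fin k, ∃ E : List ℕ, (∀ x ∈ E, x ∈ X ∧ σ[x * k + i]? = some true) ∧
      (∀ x ∈ E, ∀ y ∈ E, y ≤ x ∨ x < y ∧ f x y = i) ∧ Achieves C (F i) E (U i) (V i) (τ i)

variable {f : ℕ → ℕ → Fin k} {C X : Set ℕ} {F : Fin k → Finset ℕ} {τ : Fin k → Requirement k}

theorem IsBad.mono_prefix {U : Fin k → Set ℕ} {V : Fin k → Fin (k + 1) → Set ℕ} {σ σ' : List Bool}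
    (h : IsBad f C X F τ U V σ) (hσ : σ <+: σ') : IsBad f C X F τ U V σ' := by
  have key : ∀ {j b}, σ[j]? = some b → σ'[j]? = some b := fun {j b} hj => by
    obtain ⟨t, rfl⟩ := hσ
    rw [List.getElem?_append_left (List.getElem?_eq_some_iff.1 hj).1, hj]
  rcases h with ⟨x, hx, h⟩ | ⟨i, E, h1, h2, h3⟩
  · exact Or.inl ⟨x, hx, fun i => key (h i)⟩
  · exact Or.inr ⟨i, E, fun x hx => ⟨(h1 x hx).1, key (h1 x hx).2⟩, h2, h3⟩

theorem Achieves.mono {F : Finset ℕ} {E : List ℕ} {U U' : Set ℕ} {V V' : Fin (k + 1) → Set ℕ}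
    {r : Requirement k} (hU : U ⊆ U') (hV : ∀ l, V l ⊆ V' l) (h : Achieves C F E U V r) :
    Achieves C F E U' V' r := by
  cases r with
  | grow => exact h
  | thin e => exact h.imp fun a ha => ⟨hU ha.1, ha.2⟩
  | dense e x hx => exact fun l => (h l).imp fun a ha => ⟨hV l ha.1, ha.2⟩

theorem IsBad.mono {U U' : Fin k → Set ℕ} {V V' : Fin k → Fin (k + 1) → Set ℕ} {σ : List Bool}
    (hU : ∀ i, U i ⊆ U' i) (hV : ∀ i l, V i l ⊆ V' i l) (h : IsBad f C X F τ U V σ) :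
    IsBad f C X F τ U' V' σ :=
  h.imp_right fun ⟨i, E, h1, h2, h3⟩ => ⟨i, E, h1, h2, h3.mono (hU i) (hV i)⟩

theorem Achieves.exists_finset {F : Finset ℕ} {E : List ℕ} {U : Set ℕ} {V : Fin (k + 1) → Set ℕ}
    {r : Requirement k} (h : Achieves C F E U V r) :
    ∃ A : Finset ℕ, Achieves C F E (U ∩ A) (fun l => V l ∩ A) r := by
  cases r with
  | grow => exact ⟨∅, h⟩
  | thin e =>
    obtain ⟨a, h1, h2⟩ := h
    exact ⟨{a}, a, ⟨h1, by simp⟩, h2⟩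
  | dense e x hx =>
    choose a h1 h2 using h
    exact ⟨Finset.univ.image a, fun l => ⟨a l, ⟨h1 l, by simp⟩, h2 l⟩⟩

/-- Badness of finitely many strings uses only finitely many elements of the sets `U i`, `V i l`. -/
theorem IsBad.exists_finset {U : Fin k → Set ℕ} {V : Fin k → Fin (k + 1) → Set ℕ}
    (L : List (List Bool)) (h : ∀ σ ∈ L, IsBad f C X F τ U V σ) :
    ∃ A : Finset ℕ, ∀ σ ∈ L, IsBad f C X F τ (fun i => U i ∩ A) (fun i l => V i l ∩ A) σ := by
  induction L with
  | nil => exact ⟨∅, by simp⟩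
  | cons σ L ih =>
    obtain ⟨A, hA⟩ := ih fun σ hσ => h σ (List.mem_cons_of_mem _ hσ)
    have : ∃ A : Finset ℕ, IsBad f C X F τ (fun i => U i ∩ A) (fun i l => V i l ∩ A) σ := by
      rcases h σ List.mem_cons_self with h | ⟨i, E, h1, h2, h3⟩
      · exact ⟨∅, Or.inl h⟩
      · obtain ⟨A, hA⟩ := h3.exists_finset
        exact ⟨A, Or.inr ⟨i, E, h1, h2, hA⟩⟩
    obtain ⟨B, hB⟩ := this
    have hsub : ∀ {S : Set ℕ} {D : Finset ℕ}, D ⊆ A ∪ B → S ∩ D ⊆ S ∩ ↑(A ∪ B) :=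
      fun h => Set.inter_subset_inter_right _ (Finset.coe_subset.2 h)
    refine ⟨A ∪ B, fun υ hυ => ?_⟩
    rcases List.mem_cons.1 hυ with rfl | hυ
    · exact hB.mono (fun i => hsub Finset.subset_union_right)
        fun i l => hsub Finset.subset_union_right
    · exact (hA υ hυ).mono (fun i => hsub Finset.subset_union_left)
        fun i l => hsub Finset.subset_union_left

theorem enumIn_apply (e : EnumOperator) (C : Set ℕ) (F : Finset ℕ) :
    EnumIn C fun p : List ℕ × ℕ => p.2 ∈ e.apply (join (F ∪ {x | x ∈ p.1}) C) := by
  have hhalf : Primrec fun q : List ℕ × ℕ => q.2 / 2 := Primrec.nat_div.comp .snd (.const 2)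
  have hmem : PrimrecPred fun q : List ℕ × ℕ => q.2 / 2 ∈ (F ∪ {x | x ∈ q.1} : Set ℕ) := by
    have h1 : PrimrecRel fun (x : ℕ) (q : List ℕ × ℕ) => x = q.2 / 2 :=
      Primrec.eq.comp .fst (hhalf.comp .snd)
    refine (h1.exists_mem_list.comp (f := fun q : List ℕ × ℕ => F.toList ++ q.1)
      (Primrec.list_append.comp (Primrec.const _) .fst) Primrec.id).of_eq fun q => ?_
    simp
  have hmod : ∀ c, PrimrecPred fun q : List ℕ × ℕ => q.2 % 2 = c := fun c =>
    Primrec.eq.comp (Primrec.nat_mod.comp .snd (.const 2)) (.const c)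
  refine EnumIn.of_family (Z := fun E : List ℕ => join (F ∪ {x | x ∈ E}) C) ?_ ?_ e.2
  · exact EnumIn.of_iff ((EnumIn.of_primrec ((hmod 0).and hmem)).or
      ((EnumIn.of_primrec (hmod 1)).and (EnumIn.mem.comp hhalf))) fun q => mem_join_iff
  · exact EnumIn.of_iff ((EnumIn.of_primrec ((hmod 0).and hmem.not)).or
      ((EnumIn.of_primrec (hmod 1)).and (EnumIn.not_mem.comp hhalf))) fun q => not_mem_join_iff

theorem enumIn_achieves {F : Finset ℕ} {U : α → Set ℕ} {V : α → Fin (k + 1) → Set ℕ}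
    (hU : EnumIn (join X C) fun p : α × ℕ => p.2 ∈ U p.1)
    (hV : ∀ l, EnumIn (join X C) fun p : α × ℕ => p.2 ∈ V p.1 l) (r : Requirement k) :
    EnumIn (join X C) fun p : α × List ℕ => Achieves C F p.2 (U p.1) (V p.1) r := by
  have happ : ∀ e : EnumOperator, EnumIn (join X C) fun q : (α × List ℕ) × ℕ =>
      q.2 ∈ e.apply (join (F ∪ {x | x ∈ q.1.2}) C) := fun e =>
    (enumIn_apply e C F).join_right.comp (f := fun q : (α × List ℕ) × ℕ => (q.1.2, q.2))
      ((Primrec.snd.comp .fst).pair .snd)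
  cases r with
  | grow =>
    have h : PrimrecPred fun p : α × List ℕ => p.2 = [] :=
      Primrec.eq.comp Primrec.snd (Primrec.const [])
    exact (EnumIn.of_primrec h.not).of_iff fun p => Iff.rfl
  | thin e =>
    exact EnumIn.ex (φ := fun (p : α × List ℕ) a =>
      a ∈ U p.1 ∧ a ∈ e.apply (join (F ∪ {x | x ∈ p.2}) C))
      ((hU.comp ((Primrec.fst.comp .fst).pair .snd)).and (happ e))
  | dense e x hx =>
    exact EnumIn.forall_finite fun l => EnumIn.ex (φ := fun (p : α × List ℕ) a =>
      a ∈ V p.1 l ∧ a ∈ e.apply (join (F ∪ {x | x ∈ p.2}) C))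
      (((hV l).comp ((Primrec.fst.comp .fst).pair .snd)).and (happ e))

/-- Badness is enumerable relative to `X ⊕ C`, uniformly in parameters on which `U` and `V`
depend. -/
theorem enumIn_isBad (hf : ∀ i, EnumIn C fun p : ℕ × ℕ => p.1 < p.2 ∧ f p.1 p.2 = i)
    {U : α → Fin k → Set ℕ} {V : α → Fin k → Fin (k + 1) → Set ℕ}
    (hU : ∀ i, EnumIn (join X C) fun p : α × ℕ => p.2 ∈ U p.1 i)
    (hV : ∀ i l, EnumIn (join X C) fun p : α × ℕ => p.2 ∈ V p.1 i l) :
    EnumIn (join X C) fun p : α × List Bool => IsBad f C X F τ (U p.1) (V p.1) p.2 := by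
  have hX : EnumIn (join X C) (· ∈ X) := EnumIn.mem.join_left
  have hpos : ∀ i : Fin k, Primrec fun x : ℕ => x * k + i := fun i =>
    Primrec.nat_add.comp (Primrec.nat_mul.comp Primrec.id (.const k)) (.const (i : ℕ))
  have hbit : ∀ (i : Fin k) (b : Bool), PrimrecPred fun q : List Bool × ℕ =>
      q.1[q.2 * k + i]? = some b := fun i b =>
    Primrec.eq.comp (Primrec.list_getElem?.comp .fst ((hpos i).comp .snd)) (.const _)
  refine EnumIn.or ?_ (EnumIn.exists_finite fun i => ?_)
  · exact EnumIn.ex (φ := fun (p : α × List Bool) x =>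
      x ∈ X ∧ ∀ i : Fin k, p.2[x * k + i]? = some false)
      ((hX.comp .snd).and (EnumIn.forall_finite fun i => EnumIn.of_primrec
        ((hbit i false).comp ((Primrec.snd.comp .fst).pair .snd))))
  · refine EnumIn.ex (φ := fun (p : α × List Bool) (E : List ℕ) =>
      (∀ x ∈ E, x ∈ X ∧ p.2[x * k + i]? = some true) ∧
      (∀ x ∈ E, ∀ y ∈ E, y ≤ x ∨ x < y ∧ f x y = i) ∧
        Achieves C (F i) E (U p.1 i) (V p.1 i) (τ i)) (.and ?_ (.and ?_ ?_))
    · exact EnumIn.forall_mem_list (φ := fun (q : (α × List Bool) × List ℕ) x =>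
        x ∈ X ∧ q.1.2[x * k + i]? = some true)
        ((hX.comp .snd).and (EnumIn.of_primrec ((hbit i true).comp
          ((Primrec.snd.comp (Primrec.fst.comp .fst)).pair .snd)))) .snd
    · refine EnumIn.forall_mem_list (φ := fun (q : (α × List Bool) × List ℕ) x =>
        ∀ y ∈ q.2, y ≤ x ∨ x < y ∧ f x y = i) ?_ .snd
      refine EnumIn.forall_mem_list (φ := fun (q : ((α × List Bool) × List ℕ) × ℕ) y =>
        y ≤ q.2 ∨ q.2 < y ∧ f q.2 y = i) ?_ (Primrec.snd.comp .fst)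
      exact (EnumIn.of_primrec (Primrec.nat_le.comp .snd (Primrec.snd.comp .fst))).or
        ((hf i).join_right.comp ((Primrec.snd.comp .fst).pair .snd))
    · exact (enumIn_achieves (U := fun a => U a i) (V := fun a => V a i) (hU i) (hV i) (τ i)).comp
        ((Primrec.fst.comp .fst).pair .snd)

/-- All binary strings of length `n`. -/
def stringsOfLength : ℕ → List (List Bool)
  | 0 => [[]]
  | n + 1 => (stringsOfLength n).flatMap fun σ => [σ ++ [false], σ ++ [true]]

theorem mem_stringsOfLength {n : ℕ} {σ : List Bool} : σ ∈ stringsOfLength n ↔ σ.length = n := by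
  induction n generalizing σ with
  | zero => simp [stringsOfLength]
  | succ n ih =>
    simp only [stringsOfLength, List.mem_flatMap, ih, List.mem_cons, List.not_mem_nil, or_false]
    constructor
    · rintro ⟨υ, hυ, rfl | rfl⟩ <;> simp [hυ]
    · intro h
      rcases List.eq_nil_or_concat σ with rfl | ⟨υ, b, rfl⟩
      · simp at h
      · refine ⟨υ, by simpa using h, ?_⟩
        cases b <;> simp

theorem primrec_stringsOfLength : Primrec stringsOfLength := by
  have h : Primrec₂ fun (_ : ℕ) (L : List (List Bool)) =>
      L.flatMap fun σ => [σ ++ [false], σ ++ [true]] :=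
    (Primrec.list_flatMap Primrec.snd (Primrec.list_cons.comp
      (Primrec.list_append.comp .snd (.const [false])) (Primrec.list_cons.comp
        (Primrec.list_append.comp .snd (.const [true])) (.const []))))
  refine (Primrec.nat_rec₁ [[]] h).of_eq fun n => ?_
  induction n with
  | zero => rfl
  | succ n ih => simp only [stringsOfLength, ih]

/-- Every string of some length is bad; by compactness, every cover of `X` by `k` sets has a bad
initial segment. -/
def AllBad (f : ℕ → ℕ → Fin k) (C X : Set ℕ) (F : Fin k → Finset ℕ) (τ : Fin k → Requirement k)
    (U : Fin k → Set ℕ) (V : Fin k → Fin (k + 1) → Set ℕ) : Prop :=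
  ∃ N, ∀ σ ∈ stringsOfLength N, IsBad f C X F τ U V σ

theorem enumIn_allBad (hf : ∀ i, EnumIn C fun p : ℕ × ℕ => p.1 < p.2 ∧ f p.1 p.2 = i)
    {U : α → Fin k → Set ℕ} {V : α → Fin k → Fin (k + 1) → Set ℕ}
    (hU : ∀ i, EnumIn (join X C) fun p : α × ℕ => p.2 ∈ U p.1 i)
    (hV : ∀ i l, EnumIn (join X C) fun p : α × ℕ => p.2 ∈ V p.1 i l) :
    EnumIn (join X C) fun a : α => AllBad f C X F τ (U a) (V a) := by
  refine EnumIn.ex (φ := fun a N => ∀ σ ∈ stringsOfLength N, IsBad f C X F τ (U a) (V a) σ) ?_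
  exact EnumIn.forall_mem_list (φ := fun (p : α × ℕ) σ => IsBad f C X F τ (U p.1) (V p.1) σ)
    ((enumIn_isBad hf hU hV).comp ((Primrec.fst.comp .fst).pair .snd))
    (primrec_stringsOfLength.comp .snd)

end Strings

/-! ### Forcing conditions -/

section Forcing

variable {k : ℕ} {𝒮 : Set (Set ℕ)} {f : ℕ → ℕ → Fin k} {C : Set ℕ}

/-- A Mathias condition with one stem `stem i` for each color `i` and a common reservoir from the
Scott set. Each stem is homogeneous of its color, and stays so when an element of the reservoir is
added. -/
structure Condition (𝒮 : Set (Set ℕ)) (f : ℕ → ℕ → Fin k) where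
  stem : Fin k → Finset ℕ
  reservoir : Set ℕ
  mem : reservoir ∈ 𝒮
  infinite : reservoir.Infinite
  homogeneous : ∀ i, ∀ x ∈ stem i, ∀ y ∈ stem i, x < y → f x y = i
  stem_lt : ∀ i, ∀ x ∈ stem i, ∀ y ∈ reservoir, x < y ∧ f x y = i

/-- `d` extends `c`. -/
structure Condition.Extends (d c : Condition 𝒮 f) : Prop where
  stem_subset : ∀ i, c.stem i ⊆ d.stem i
  subset_union : ∀ i, (d.stem i : Set ℕ) ⊆ c.stem i ∪ c.reservoir
  reservoir_subset : d.reservoir ⊆ c.reservoir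

/-- `G` is a possible homogeneous set of color `i` in the eyes of the condition `c`. -/
structure Condition.Allows (c : Condition 𝒮 f) (i : Fin k) (G : Set ℕ) : Prop where
  stem_subset : (c.stem i : Set ℕ) ⊆ G
  subset_union : G ⊆ c.stem i ∪ c.reservoir
  homogeneous : ∀ x ∈ G, ∀ y ∈ G, x < y → f x y = i

/-- The `l`-th of the open intervals determined by a row of rationals. -/
def rowInterval {n : ℕ} (x : Fin n → ℚ) (l : Fin (n + 1)) : Set ℚ :=
  {q | (∀ j : Fin n, j.castSucc < l → x j < q) ∧ (∀ j : Fin n, l ≤ j.castSucc → q < x j)}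

/-- The set `G` satisfies the requirement, see `Requirement`. -/
def Requirement.Holds (p : RatPresentation) (A₀ A₁ : Set ℚ) (C G : Set ℕ) : Requirement k → Prop
  | .grow => G.Infinite
  | .thin e => ¬ (e.apply (join G C) ⊆ p.enum ⁻¹' A₀ ∧ (e.apply (join G C)).Infinite)
  | .dense e x _ => ¬ (e.apply (join G C) ⊆ p.enum ⁻¹' A₁ ∧
      ∀ l, (e.apply (join G C) ∩ p.enum ⁻¹' rowInterval x l).Infinite)

/-- `d` makes progress on the requirement `r` for the color `i`: it lengthens the stem in case of
`grow`, and it guarantees the requirement in the other cases. -/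
def Condition.Advances (p : RatPresentation) (A₀ A₁ : Set ℚ) (C : Set ℕ) (d c : Condition 𝒮 f)
    (i : Fin k) (r : Requirement k) : Prop :=
  (r = .grow → c.stem i ⊂ d.stem i) ∧
    (r ≠ .grow → ∀ G, d.Allows i G → r.Holds p A₀ A₁ C G)

theorem initialSegment_join_congr {G G' : Set ℕ} {n : ℕ} (h : ∀ x < n, x ∈ G ↔ x ∈ G') :
    initialSegment (join G C) n = initialSegment (join G' C) n := by
  refine initialSegment_congr fun j hj => ?_
  rw [mem_join_iff, mem_join_iff, h (j / 2) (by omega)]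

theorem IsScottSet.setOf_ge_inter_mem (h𝒮 : IsScottSet 𝒮) {X : Set ℕ} (hX : X ∈ 𝒮) (b : ℕ) :
    X ∩ {y | b ≤ y} ∈ 𝒮 :=
  h𝒮.inter_mem hX (h𝒮.mem_of_primrecPred hX (Primrec.nat_le.comp (.const b) .id))

theorem infinite_inter_setOf_ge {X : Set ℕ} (hX : X.Infinite) (b : ℕ) :
    (X ∩ {y | b ≤ y}).Infinite := by
  refine (hX.sdiff (Set.finite_lt_nat b)).mono fun x hx => ⟨hx.1, ?_⟩
  simpa using hx.2

theorem IsScottSet.setOf_color_mem (h𝒮 : IsScottSet 𝒮) (hC : C ∈ 𝒮)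
    (hf : ∀ i, EnumIn C fun p : ℕ × ℕ => p.1 < p.2 ∧ f p.1 p.2 = i) (x : ℕ) (i : Fin k) :
    {y | x < y ∧ f x y = i} ∈ 𝒮 := by
  have hx : Primrec fun y : ℕ => (x, y) := (Primrec.const x).pair Primrec.id
  refine h𝒮.mem_of_enumIn hC ((hf i).comp hx) ?_
  refine ((EnumIn.of_primrec (Primrec.nat_le.comp .id (.const x))).or (EnumIn.exists_finite
    (ι := {j : Fin k // j ≠ i}) fun j => (hf j).comp hx)).of_iff fun y => ?_
  simp only [Set.mem_ofPred_eq, not_and_or, not_lt]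
  refine or_congr_right' fun hy => ⟨fun h => ⟨⟨f x y, h⟩, not_le.1 hy, rfl⟩, ?_⟩
  rintro ⟨⟨j, hj⟩, -, h⟩
  exact fun h' => hj (h.symm.trans h')

/-- A member of the Scott set can be thinned so that each of finitely many given numbers has a
limit color. -/
theorem IsScottSet.exists_limit (h𝒮 : IsScottSet 𝒮) (hC : C ∈ 𝒮)
    (hf : ∀ i, EnumIn C fun p : ℕ × ℕ => p.1 < p.2 ∧ f p.1 p.2 = i) {X : Set ℕ} (hX : X ∈ 𝒮)
    (hinf : X.Infinite) (N : ℕ) :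
    ∃ X' ⊆ X, X' ∈ 𝒮 ∧ X'.Infinite ∧ ∀ x < N, ∃ i, ∀ y ∈ X', x < y ∧ f x y = i := by
  induction N with
  | zero => exact ⟨X, subset_rfl, hX, hinf, by simp⟩
  | succ N ih =>
    obtain ⟨X', hsub, hmem, hinf', hlim⟩ := ih
    obtain ⟨i, hi⟩ := exists_infinite_inter (infinite_inter_setOf_ge hinf' (N + 1))
      (Z := fun i : Fin k => {y | N < y ∧ f N y = i}) fun y hy => ⟨f N y, hy.2, rfl⟩
    refine ⟨X' ∩ {y | N < y ∧ f N y = i}, Set.inter_subset_left.trans hsub,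
      h𝒮.inter_mem hmem (h𝒮.setOf_color_mem hC hf N i),
      hi.mono (Set.inter_subset_inter_left _ Set.inter_subset_left), fun x hx => ?_⟩
    rcases Nat.lt_succ_iff_lt_or_eq.1 hx with hx | rfl
    · obtain ⟨j, hj⟩ := hlim x hx
      exact ⟨j, fun y hy => hj y hy.1⟩
    · exact ⟨i, fun y hy => hy.2⟩

/-- A member of the Scott set can be thinned into one piece of each of finitely many covers by
`k` sets. -/
theorem IsScottSet.exists_refinement (h𝒮 : IsScottSet 𝒮) {X : Set ℕ} (hX : X ∈ 𝒮)
    (hinf : X.Infinite) {ι : Type*} [Finite ι] (P : ι → Set ℕ) (hP : ∀ t, P t ∈ 𝒮)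
    (hcover : ∀ t, ∀ x ∈ X, ∃ i : Fin k, x * k + i ∈ P t) :
    ∃ X' ⊆ X, X' ∈ 𝒮 ∧ X'.Infinite ∧ ∃ c : ι → Fin k, ∀ t, ∀ x ∈ X', x * k + c t ∈ P t := by
  classical
  have hpiece : ∀ t (i : Fin k), {x | x * k + i ∈ P t} ∈ 𝒮 := fun t i => by
    have hpos : Primrec fun x : ℕ => x * k + i :=
      Primrec.nat_add.comp (Primrec.nat_mul.comp Primrec.id (.const k)) (.const (i : ℕ))
    exact h𝒮.mem_of_enumIn (hP t) (EnumIn.mem.comp hpos) (EnumIn.not_mem.comp hpos)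
  have := Fintype.ofFinite ι
  have key : ∀ s : Finset ι, ∃ X' ⊆ X, X' ∈ 𝒮 ∧ X'.Infinite ∧
      ∀ t ∈ s, ∃ i : Fin k, ∀ x ∈ X', x * k + i ∈ P t := by
    intro s
    induction s using Finset.induction_on with
    | empty => exact ⟨X, subset_rfl, hX, hinf, by simp⟩
    | insert t s _ ih =>
      obtain ⟨X', hsub, hmem, hinf', h⟩ := ih
      obtain ⟨i, hi⟩ := exists_infinite_inter hinf'
        (Z := fun i : Fin k => {x | x * k + i ∈ P t}) fun x hx => hcover t x (hsub hx)
      refine ⟨_, Set.inter_subset_left.trans hsub, h𝒮.inter_mem hmem (hpiece t i), hi, ?_⟩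
      intro t' ht'
      rcases Finset.mem_insert.1 ht' with rfl | ht'
      · exact ⟨i, fun x hx => hx.2⟩
      · obtain ⟨j, hj⟩ := h t' ht'
        exact ⟨j, fun x hx => hj x hx.1⟩
  obtain ⟨X', h1, h2, h3, h4⟩ := key Finset.univ
  choose c hc using fun t => h4 t (Finset.mem_univ t)
  exact ⟨X', h1, h2, h3, c, hc⟩

theorem Condition.Extends.refl (c : Condition 𝒮 f) : c.Extends c :=
  ⟨fun _ => subset_rfl, fun _ => Set.subset_union_left, subset_rfl⟩

theorem Condition.Extends.trans {c d e : Condition 𝒮 f} (h₁ : e.Extends d) (h₂ : d.Extends c) :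
    e.Extends c where
  stem_subset i := (h₂.stem_subset i).trans (h₁.stem_subset i)
  subset_union i := (h₁.subset_union i).trans (Set.union_subset (h₂.subset_union i)
    (h₂.reservoir_subset.trans Set.subset_union_right))
  reservoir_subset := h₁.reservoir_subset.trans h₂.reservoir_subset

/-- Lengthening one stem by a finite homogeneous set of numbers with the right limit color. -/
theorem Condition.exists_extends (c : Condition 𝒮 f) {i : Fin k} {E : List ℕ} {X' : Set ℕ}
    (hE : ∀ x ∈ E, x ∈ c.reservoir) (hhom : ∀ x ∈ E, ∀ y ∈ E, x < y → f x y = i)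
    (hX' : X' ⊆ c.reservoir) (hmem : X' ∈ 𝒮) (hinf : X'.Infinite)
    (hlim : ∀ x ∈ E, ∀ y ∈ X', x < y ∧ f x y = i) :
    ∃ d : Condition 𝒮 f, d.Extends c ∧ (d.stem i : Set ℕ) = (c.stem i : Set ℕ) ∪ {x | x ∈ E} ∧
      d.reservoir = X' := by
  have hstem : ∀ j x, x ∈ (if j = i then c.stem i ∪ E.toFinset else c.stem j) ↔
      x ∈ c.stem j ∨ (j = i ∧ x ∈ E) := by
    intro j x
    by_cases hj : j = i
    · subst hj; simp
    · simp [hj]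
  refine ⟨⟨fun j => if j = i then c.stem i ∪ E.toFinset else c.stem j, X', hmem, hinf, ?_, ?_⟩,
    ⟨?_, ?_, hX'⟩, ?_, rfl⟩
  · intro j x hx y hy hxy
    rcases (hstem j x).1 hx with hxF | ⟨rfl, hxE⟩
    · rcases (hstem j y).1 hy with hyF | ⟨rfl, hyE⟩
      · exact c.homogeneous j x hxF y hyF hxy
      · exact (c.stem_lt _ x hxF y (hE y hyE)).2
    · rcases (hstem j y).1 hy with hyF | ⟨-, hyE⟩
      · exact absurd (c.stem_lt _ y hyF x (hE x hxE)).1 hxy.asymm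
      · exact hhom x hxE y hyE hxy
  · intro j x hx y hy
    rcases (hstem j x).1 hx with hxF | ⟨rfl, hxE⟩
    · exact c.stem_lt j x hxF y (hX' hy)
    · exact hlim x hxE y hy
  · exact fun j x hx => (hstem j x).2 (Or.inl hx)
  · intro j x hx
    rcases (hstem j x).1 hx with hxF | ⟨rfl, hxE⟩
    · exact Or.inl hxF
    · exact Or.inr (hE x hxE)
  · ext x
    simp

/-- The case in which all strings are bad: the limit colors of an initial segment of the reservoir
provide such a string, and the set `E` that witnesses its badness is added to a stem. -/
theorem exists_advances_of_allBad {p : RatPresentation} {A₀ A₁ : Set ℚ} (hA : Disjoint A₀ A₁)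
    (h𝒮 : IsScottSet 𝒮) (hC : C ∈ 𝒮)
    (hf : ∀ i, EnumIn C fun p : ℕ × ℕ => p.1 < p.2 ∧ f p.1 p.2 = i) (c : Condition 𝒮 f)
    (τ : Fin k → Requirement k) {U : Fin k → Set ℕ} {V : Fin k → Fin (k + 1) → Set ℕ}
    (hU : ∀ i, U i ⊆ p.enum ⁻¹' A₁) (hV : ∀ i, ∃ l, V i l ⊆ p.enum ⁻¹' A₀)
    (hbad : AllBad f C c.reservoir c.stem τ U V) :
    ∃ d : Condition 𝒮 f, d.Extends c ∧ ∃ i, d.Advances p A₀ A₁ C c i (τ i) := by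
  obtain ⟨N, hN⟩ := hbad
  obtain ⟨X', hX', hmem, hinf, hlim⟩ := h𝒮.exists_limit hC hf c.mem c.infinite N
  have hk : 0 < k := (f 0 0).pos
  have : ∃ col : ℕ → Fin k, ∀ x < N, ∀ y ∈ X', x < y ∧ f x y = col x := by
    have : Nonempty (Fin k) := ⟨f 0 0⟩
    choose! col hcol using hlim
    exact ⟨col, hcol⟩
  obtain ⟨col, hcol⟩ := this
  let σ : List Bool := (List.range N).map fun b => decide (b % k = col (b / k))
  have hσ : ∀ (x : ℕ) (i : Fin k) (b : Bool), σ[x * k + i]? = some b →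
      x < N ∧ decide (i = col x) = b := by
    intro x i b h
    have hlt : x * k + i < N := by
      by_contra hge
      rw [List.getElem?_eq_none (by simp [σ]; omega)] at h
      exact absurd h (by simp)
    have hmod : (x * k + i) % k = i := by
      rw [Nat.mul_comm, Nat.mul_add_mod, Nat.mod_eq_of_lt i.2]
    have hdiv : (x * k + i) / k = x := by
      rw [Nat.mul_comm, Nat.mul_add_div hk, Nat.div_eq_of_lt i.2, Nat.add_zero]
    have hx : x ≤ x * k := Nat.le_mul_of_pos_right x hk
    refine ⟨by omega, ?_⟩
    simpa [σ, hlt, hmod, hdiv, Fin.val_inj] using h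
  have hlen : σ.length = N := by simp [σ]
  rcases hN σ (mem_stringsOfLength.2 hlen) with ⟨x, -, hx⟩ | ⟨i, E, hE, hhom, hach⟩
  · simpa using (hσ x _ _ (hx (col x))).2
  have hElim : ∀ x ∈ E, ∀ y ∈ X', x < y ∧ f x y = i := by
    intro x hx
    obtain ⟨h1, h2⟩ := hσ x i true (hE x hx).2
    rw [of_decide_eq_true h2]
    exact hcol x h1
  have hhom' : ∀ x ∈ E, ∀ y ∈ E, x < y → f x y = i := fun x hx y hy hxy =>
    (hhom x hx y hy).elim (fun h => absurd hxy (not_lt.2 h)) And.right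
  -- An enumeration from the new stem persists if the reservoir starts above its use.
  have key : ∀ (e : EnumOperator) (a : ℕ),
      a ∈ e.apply (join (c.stem i ∪ {x | x ∈ E}) C) → ∃ d : Condition 𝒮 f, d.Extends c ∧
        ∀ G, d.Allows i G → a ∈ e.apply (join G C) := by
    rintro e a ⟨n, hn⟩
    obtain ⟨d, h1, h2, h3⟩ := c.exists_extends (i := i) (E := E) (X' := X' ∩ {y | n ≤ y})
      (fun x hx => (hE x hx).1) hhom' (Set.inter_subset_left.trans hX')
      (h𝒮.setOf_ge_inter_mem hmem n) (infinite_inter_setOf_ge hinf n)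
      (fun x hx y hy => hElim x hx y hy.1)
    refine ⟨d, h1, fun G hG => ⟨n, ?_⟩⟩
    rw [initialSegment_join_congr (G' := c.stem i ∪ {x | x ∈ E}) fun x hx => ?_]
    · exact hn
    · rw [← h2]
      refine ⟨fun hxG => (hG.subset_union hxG).resolve_right fun hxX => ?_,
        fun h => hG.stem_subset h⟩
      rw [h3] at hxX
      exact absurd hx (not_lt.2 hxX.2)
  generalize hr : τ i = r at hach
  cases r with
  | grow =>
    obtain ⟨d, h1, h2, -⟩ := c.exists_extends (fun x hx => (hE x hx).1) hhom' hX' hmem hinf hElim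
    refine ⟨d, h1, i, fun _ => ?_, fun h => absurd hr h⟩
    obtain ⟨x, hx⟩ := List.exists_mem_of_ne_nil E hach
    refine Finset.ssubset_iff_subset_ne.2 ⟨h1.stem_subset i, fun heq => ?_⟩
    have hxd : x ∈ c.stem i := by
      rw [heq, ← Finset.mem_coe, h2]
      exact Or.inr hx
    exact lt_irrefl x (c.stem_lt i x hxd x (hE x hx).1).1
  | thin e =>
    obtain ⟨a, haU, ha⟩ := hach
    obtain ⟨d, h1, h2⟩ := key e a ha
    refine ⟨d, h1, i, fun h => by simp [hr] at h, fun _ G hG => ?_⟩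
    rw [hr]
    exact fun h => Set.disjoint_left.1 hA (h.1 (h2 G hG)) (hU i haU)
  | dense e x hx =>
    obtain ⟨l, hl⟩ := hV i
    obtain ⟨a, haV, ha⟩ := hach l
    obtain ⟨d, h1, h2⟩ := key e a ha
    refine ⟨d, h1, i, fun h => by simp [hr] at h, fun _ G hG => ?_⟩
    rw [hr]
    exact fun h => Set.disjoint_left.1 hA (hl haV) (h.1 (h2 G hG))

end Forcing

/-! ### Progress on one requirement for some color -/

section Progress

variable {k : ℕ} {𝒮 : Set (Set ℕ)} {f : ℕ → ℕ → Fin k} {C : Set ℕ} {p : RatPresentation}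

theorem RatMatrix.exists_mem_interval {m n : ℕ} (M : RatMatrix m n) (i : Fin m) {q : ℚ}
    (hq : ∀ j, q ≠ M.entry i j) : ∃ l, q ∈ M.interval i l := by
  classical
  by_cases h : ∃ j, q < M.entry i j
  · obtain ⟨j, hj, hmin⟩ := Finset.exists_minimal (s := Finset.univ.filter fun j => q < M.entry i j)
      (by obtain ⟨j, hj⟩ := h; exact ⟨j, by simpa using hj⟩)
    simp only [Finset.mem_filter, Finset.mem_univ, true_and] at hj hmin
    refine ⟨j.castSucc, fun j' hj' => ?_, fun j' hj' => ?_⟩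
    · refine lt_of_le_of_ne (not_lt.1 fun hlt => ?_) (hq j').symm
      have h1 : j' < j := Fin.castSucc_lt_castSucc_iff.1 hj'
      exact absurd (hmin hlt h1.le) (not_le.2 h1)
    · exact hj.trans_le ((M.strictMono i).monotone (Fin.castSucc_le_castSucc_iff.1 hj'))
  · refine ⟨Fin.last n, fun j _ => ?_, fun j hj => ?_⟩
    · exact lt_of_le_of_ne (not_lt.1 fun hlt => h ⟨j, hlt⟩) (hq j).symm
    · exact absurd (Fin.castSucc_lt_last j) (not_lt.2 hj)

theorem enumIn_mem_interval (p : RatPresentation) {m n : ℕ} (M : RatMatrix m n) (i : Fin m)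
    (l : Fin (n + 1)) {X : Set ℕ} : EnumIn X fun a : ℕ => p.enum a ∈ M.interval i l := by
  have hlt : ∀ j, PrimrecPred fun a : ℕ => M.entry i j < p.enum a := fun j =>
    (p.primrec_lt.comp (Primrec.const (p.enum.symm (M.entry i j))) Primrec.id).of_eq
      fun a => by simp
  have hgt : ∀ j, PrimrecPred fun a : ℕ => p.enum a < M.entry i j := fun j =>
    (p.primrec_lt.comp Primrec.id (Primrec.const (p.enum.symm (M.entry i j)))).of_eq
      fun a => by simp
  have himp : ∀ (P : Prop) (φ : ℕ → Prop), EnumIn X φ → EnumIn X fun a => P → φ a :=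
    fun P φ h => by
      by_cases hP : P
      · simpa [hP] using h
      · exact (EnumIn.of_primrec (Primrec.eq.comp (.const 0) (.const 0))).of_iff
          fun a => by simp [hP]
  exact (EnumIn.forall_finite fun j => himp _ _ (EnumIn.of_primrec (hlt j))).and
    (EnumIn.forall_finite fun j => himp _ _ (EnumIn.of_primrec (hgt j)))

theorem testBit_code (p : RatPresentation) (F : Finset ℚ) (a : ℕ) :
    (p.code F).testBit a ↔ p.enum a ∈ F := by
  have h : p.code F = ∑ x ∈ F.map p.enum.symm.toEmbedding, 2 ^ x := by
    simp [RatPresentation.code, RatPresentation.index]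
  rw [h, ← Nat.mem_bitIndices, ← List.mem_toFinset, Finset.toFinset_bitIndices_sum_two_pow]
  simp

theorem primrecRel_testBit : PrimrecRel fun u a : ℕ => u.testBit a = true := by
  have hpow : Primrec fun a : ℕ => 2 ^ a :=
    (Primrec₂.unpaired'.1 Nat.Primrec.pow).comp (Primrec.const 2) Primrec.id
  have h : PrimrecPred fun q : ℕ × ℕ => q.1 / 2 ^ q.2 % 2 = 1 :=
    Primrec.eq.comp (Primrec.nat_mod.comp (Primrec.nat_div.comp .fst (hpow.comp .snd)) (.const 2))
      (.const 1)
  exact h.of_eq fun q => by simp [Nat.testBit_eq_decide_div_mod_eq]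

/-- The formula of the sets `U`, `V` of rationals that says that all strings of some length are
bad. -/
def badFormula (p : RatPresentation) (f : ℕ → ℕ → Fin k) (C X : Set ℕ) (F : Fin k → Finset ℕ)
    (τ : Fin k → Requirement k) : MFormula k k := fun R S =>
  AllBad f C X F τ (fun i => p.enum ⁻¹' R i) (fun i l => p.enum ⁻¹' S i l)

theorem isSigmaOne_badFormula (hf : ∀ i, EnumIn C fun p : ℕ × ℕ => p.1 < p.2 ∧ f p.1 p.2 = i)
    (X : Set ℕ) (F : Fin k → Finset ℕ) (τ : Fin k → Requirement k) :
    (badFormula p f C X F τ).IsSigmaOne p (join X C) := by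
  refine ⟨fun w => AllBad f C X F τ (fun i => {a | (w.1 i).testBit a = true})
    (fun i l => {a | (w.2 i l).testBit a = true}), EnumIn.sigmaOne ?_, fun R S => ?_⟩
  · have happ : ∀ {n : ℕ} {β : Type} [Primcodable β] (i : Fin n),
        Primrec fun u : Fin n → β => u i := fun i => Primrec.fin_app.comp Primrec.id (Primrec.const i)
    refine enumIn_allBad (α := (Fin k → ℕ) × (Fin k → Fin (k + 1) → ℕ)) hf
      (U := fun w i => {a | (w.1 i).testBit a = true})
      (V := fun w i l => {a | (w.2 i l).testBit a = true}) (fun i => ?_) (fun i l => ?_)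
    · exact EnumIn.of_primrec
        (primrecRel_testBit.comp ((happ i).comp (Primrec.fst.comp .fst)) .snd)
    · exact EnumIn.of_primrec (primrecRel_testBit.comp
        ((happ l).comp ((happ i).comp (Primrec.snd.comp .fst))) .snd)
  · have h : ∀ G : Finset ℚ, {a | (p.code G).testBit a = true} = p.enum ⁻¹' G := fun G => by
      ext a
      exact testBit_code p G a
    simp only [h]
    rfl

/-- The names greater than `s` of the elements of the cell given by the choice `r` of an interval
in each row. -/
def cellAbove (p : RatPresentation) {m n : ℕ} (M : RatMatrix m n) (s : ℕ)
    (r : Fin m → Fin (n + 1)) : Set ℕ :=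
  {a | s < a ∧ ∀ i, p.enum a ∈ M.interval i (r i)}

/-- The names greater than `s` of the elements of an interval. -/
def intervalAbove (p : RatPresentation) {m n : ℕ} (M : RatMatrix m n) (s : ℕ) (i : Fin m)
    (l : Fin (n + 1)) : Set ℕ :=
  {a | s < a ∧ p.enum a ∈ M.interval i l}

/-- If the formula is not essential, as witnessed by `s`, then for each type `T` some member of the
Scott set codes a cover of the reservoir without bad initial segments, where badness refers to
the names greater than `s` of the elements of `T` and of the intervals. -/
theorem exists_cover_avoiding (h𝒮 : IsScottSet 𝒮) (hC : C ∈ 𝒮)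
    (hf : ∀ i, EnumIn C fun p : ℕ × ℕ => p.1 < p.2 ∧ f p.1 p.2 = i) {X : Set ℕ} (hX : X ∈ 𝒮)
    {F : Fin k → Finset ℕ} {τ : Fin k → Requirement k} {M : RatMatrix k k} {s : ℕ}
    (hs : ∀ T, M.IsType T → ∀ v : Valuation M, v.Above p s → v.OfType T →
      ¬ v.Satisfies (badFormula p f C X F τ))
    (t : Fin k → Fin k → Fin (k + 1)) (ht : ∀ j, (⋂ i, M.interval i (t j i)).Nonempty) :
    ∃ P ∈ 𝒮, ∀ n, ¬ IsBad f C X F τ (fun j => cellAbove p M s (t j)) (intervalAbove p M s)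
      (initialSegment P n) := by
  classical
  have habove : EnumIn (join X C) fun a : ℕ => s < a :=
    EnumIn.of_primrec (Primrec.nat_lt.comp (.const s) .id)
  have henum : EnumIn (join X C) fun σ => IsBad f C X F τ (fun j => cellAbove p M s (t j))
      (intervalAbove p M s) σ :=
    (enumIn_isBad (α := Unit) hf (U := fun _ j => cellAbove p M s (t j))
      (V := fun _ => intervalAbove p M s)
      (fun j => (habove.and (EnumIn.forall_finite fun i =>
        enumIn_mem_interval p M i (t j i))).comp Primrec.snd)
      (fun i l => (habove.and (enumIn_mem_interval p M i l)).comp Primrec.snd)).comp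
      ((Primrec.const ()).pair Primrec.id)
  refine h𝒮.exists_avoiding (h𝒮.join_mem X hX C hC) henum fun N => ?_
  by_contra! hcon
  have hall : ∀ σ ∈ stringsOfLength N, IsBad f C X F τ (fun j => cellAbove p M s (t j))
      (intervalAbove p M s) σ := fun σ hσ => by
    obtain ⟨υ, hυ, hbad⟩ := hcon σ (mem_stringsOfLength.1 hσ)
    exact hbad.mono_prefix hυ
  obtain ⟨A, hA⟩ := IsBad.exists_finset _ hall
  -- The finitely many elements that badness uses form a valuation satisfying the formula.
  let pick : Set ℕ → Finset ℚ := fun U => (A.filter (· ∈ U)).map p.enum.toEmbedding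
  have hpick : ∀ U q, q ∈ pick U ↔ p.enum.symm q ∈ A ∧ p.enum.symm q ∈ U := by
    intro U q
    simp only [pick, Finset.mem_map_equiv, Finset.mem_filter]
  have hpre : ∀ U : Set ℕ, U ∩ A ⊆ p.enum ⁻¹' pick U := fun U a ha => by
    simp only [Set.mem_preimage, Finset.mem_coe, hpick, Equiv.symm_apply_apply]
    exact ⟨ha.2, ha.1⟩
  let v : Valuation M :=
    { R := fun j => pick (cellAbove p M s (t j))
      S := fun i l => pick (intervalAbove p M s i l)
      subset_interval := fun i l q hq => by
        have h := ((hpick _ q).1 hq).2.2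
        simpa using h }
  refine hs (fun j => ⋂ i, M.interval i (t j i)) (fun j => ⟨ht j, t j, rfl⟩) v
    ⟨fun j q hq => ((hpick _ q).1 hq).2.1, fun i l q hq => ((hpick _ q).1 hq).2.1⟩
    (fun j q hq => ?_) ⟨N, fun σ hσ => (hA σ hσ).mono (fun j => hpre _) fun i l => hpre _⟩
  have h := ((hpick _ q).1 hq).2.2
  simpa using h

/-- The case in which the formula is not essential: the reservoir is refined to one piece of each
of the covers that belong to the finitely many types. -/
theorem exists_advances_of_not_essential (A₀ A₁ : Set ℚ) (h𝒮 : IsScottSet 𝒮) (hC : C ∈ 𝒮)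
    (hf : ∀ i, EnumIn C fun p : ℕ × ℕ => p.1 < p.2 ∧ f p.1 p.2 = i) (c : Condition 𝒮 f)
    (τ : Fin k → Requirement k) {M : RatMatrix k k}
    (hM : ∀ i e x hx, τ i = .dense e x hx → M.entry i = x)
    (hess : ¬ (badFormula p f C c.reservoir c.stem τ).IsEssential p M) :
    ∃ d : Condition 𝒮 f, d.Extends c ∧ ∃ i, d.Advances p A₀ A₁ C c i (τ i) := by
  classical
  unfold MFormula.IsEssential at hess
  push Not at hess
  obtain ⟨s, hs⟩ := hess
  let ι := {t : Fin k → Fin k → Fin (k + 1) // ∀ j, (⋂ i, M.interval i (t j i)).Nonempty}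
  choose P hP hgood using fun t : ι =>
    exists_cover_avoiding (p := p) h𝒮 hC hf c.mem hs t.1 t.2
  have hbit : ∀ t j n, j < n →
      (initialSegment (P t) n)[j]? = some (decide (j ∈ P t)) :=
    fun t j n h => getElem?_initialSegment (P t) n j h
  have hcover : ∀ t, ∀ x ∈ c.reservoir, ∃ i : Fin k, x * k + i ∈ P t := by
    intro t x hx
    by_contra! h
    refine hgood t (x * k + k) (Or.inl ⟨x, hx, fun i => ?_⟩)
    rw [hbit t _ _ (by omega), decide_eq_false (h i)]
  obtain ⟨X', hX', hmem, hinf, col, hcol⟩ :=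
    h𝒮.exists_refinement c.mem c.infinite P hP hcover
  -- No finite homogeneous subset of the refined reservoir makes progress.
  have key : ∀ t, ∀ E : List ℕ, (∀ x ∈ E, x ∈ X') →
      (∀ x ∈ E, ∀ y ∈ E, x < y → f x y = col t) →
      ¬ Achieves C (c.stem (col t)) E (cellAbove p M s (t.1 (col t)))
        (intervalAbove p M s (col t)) (τ (col t)) := by
    intro t E hE hhom hach
    obtain ⟨b, hb⟩ : ∃ b, ∀ x ∈ E, x < b := by
      refine ⟨E.sum + 1, fun x hx => Nat.lt_succ_of_le (List.single_le_sum (by simp) x hx)⟩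
    refine hgood t (b * k) (Or.inr ⟨col t, E, fun x hx => ⟨hX' (hE x hx), ?_⟩,
      fun x hx y hy => ?_, hach⟩)
    · have h1 : (x + 1) * k ≤ b * k := Nat.mul_le_mul_right k (hb x hx)
      have h2 := (col t).2
      rw [hbit t _ _ (by rw [Nat.add_mul] at h1; omega), decide_eq_true (hcol t x (hE x hx))]
    · exact (le_or_gt y x).imp_right fun h => ⟨h, hhom x hx y hy h⟩
  let d : Condition 𝒮 f := ⟨c.stem, X', hmem, hinf, c.homogeneous,
    fun i x hx y hy => c.stem_lt i x hx y (hX' hy)⟩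
  have hd : d.Extends c := ⟨fun _ => subset_rfl, fun _ => Set.subset_union_left, hX'⟩
  have trace : ∀ i G, d.Allows i G → ∀ n, ∃ E : List ℕ, (∀ x ∈ E, x ∈ X') ∧
      (∀ x ∈ E, ∀ y ∈ E, x < y → f x y = i) ∧ ∀ m ≤ n, initialSegment (join G C) m =
        initialSegment (join (c.stem i ∪ {x | x ∈ E}) C) m := by
    intro i G hG n
    have hmemE : ∀ x, x ∈ (List.range n).filter (fun x => x ∈ G ∧ x ∉ c.stem i) ↔
        x < n ∧ x ∈ G ∧ x ∉ c.stem i := fun x => by simp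
    refine ⟨(List.range n).filter (fun x => x ∈ G ∧ x ∉ c.stem i), fun x hx => ?_,
      fun x hx y hy => hG.homogeneous x ((hmemE x).1 hx).2.1 y ((hmemE y).1 hy).2.1,
      fun m hm => initialSegment_join_congr fun x hx => ?_⟩
    · obtain ⟨-, h1, h2⟩ := (hmemE x).1 hx
      exact (hG.subset_union h1).resolve_left h2
    · simp only [Set.mem_union, Finset.mem_coe, Set.mem_ofPred_eq, hmemE]
      constructor
      · exact fun h => or_iff_not_imp_left.2 fun h' => ⟨by omega, h, h'⟩
      · rintro (h | h)
        · exact hG.stem_subset h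
        · exact h.2.1
  by_cases hgrow : ∃ t, τ (col t) = .grow
  · obtain ⟨t, ht⟩ := hgrow
    obtain ⟨x, hx⟩ := hinf.nonempty
    refine absurd ?_ (key t [x] (by simpa using hx) (by simp))
    rw [ht]
    exact List.cons_ne_nil x []
  by_cases hdense : ∃ t e x hx, τ (col t) = .dense e x hx
  · obtain ⟨t, e, x, hx, ht⟩ := hdense
    refine ⟨d, hd, col t, fun h => absurd ⟨t, h⟩ hgrow, fun _ G hG => ?_⟩
    rw [ht]
    rintro ⟨-, hG'⟩
    have hbig : ∀ l, ∃ a n, a ∈ intervalAbove p M s (col t) l ∧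
        e.1 (initialSegment (join G C) n) a := by
      intro l
      obtain ⟨a, ⟨⟨n, hn⟩, hal⟩, has⟩ := (hG' l).exists_notMem_finite (Set.finite_le_nat s)
      refine ⟨a, n, ⟨by simpa using has, ?_⟩, hn⟩
      have h : M.interval (col t) l = rowInterval x l := by
        rw [← hM _ _ _ _ ht]; rfl
      rw [h]
      exact hal
    choose a n ha hn using hbig
    obtain ⟨E, hE, hhom, hseg⟩ := trace _ G hG (Finset.univ.sup n)
    refine key t E hE hhom ?_
    rw [ht]
    refine fun l => ⟨a l, ha l, n l, ?_⟩
    rw [← hseg _ (Finset.le_sup (Finset.mem_univ l))]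
    exact hn l
  -- Otherwise all covers have put the reservoir into a `thin` color. Some color `j` is responsible
  -- for every cell: if each color `j` had a cell `r j` for which it is never responsible, the type
  -- with the cells `r j` would belong to no color.
  have hj : ∃ j, ∀ r : Fin k → Fin (k + 1), (⋂ i, M.interval i (r i)).Nonempty →
      ∃ t : ι, t.1 j = r ∧ col t = j := by
    by_contra! h
    choose r hr hcolr using h
    exact hcolr _ ⟨r, hr⟩ rfl rfl
  obtain ⟨j, hj⟩ := hj
  have hentries : (⋃ i, Set.range (M.entry i)).Finite :=
    Set.finite_iUnion fun i => Set.finite_range _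
  have hcell : ∀ q ∉ ⋃ i, Set.range (M.entry i), ∃ r : Fin k → Fin (k + 1),
      q ∈ ⋂ i, M.interval i (r i) := by
    intro q hq
    have h : ∀ i, ∃ l, q ∈ M.interval i l := fun i => M.exists_mem_interval i fun j' h =>
      hq (Set.mem_iUnion.2 ⟨i, j', h.symm⟩)
    choose r hr using h
    exact ⟨r, Set.mem_iInter.2 hr⟩
  obtain ⟨q₀, hq₀⟩ := hentries.infinite_compl.nonempty
  obtain ⟨r₀, hr₀⟩ := hcell q₀ hq₀
  obtain ⟨t₀, -, ht₀⟩ := hj r₀ ⟨q₀, hr₀⟩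
  refine ⟨d, hd, j, fun h => absurd ⟨t₀, ht₀ ▸ h⟩ hgrow, fun _ G hG => ?_⟩
  generalize hτ : τ j = r'
  cases r' with
  | grow => exact absurd ⟨t₀, ht₀ ▸ hτ⟩ hgrow
  | dense e x hx => exact absurd ⟨t₀, e, x, hx, ht₀ ▸ hτ⟩ hdense
  | thin e =>
    rintro ⟨-, hG'⟩
    obtain ⟨a, ⟨n, hn⟩, ha⟩ := hG'.exists_notMem_finite
      ((Set.finite_le_nat s).union (hentries.preimage p.enum.injective.injOn))
    rw [Set.mem_union, not_or] at ha
    obtain ⟨r, hr⟩ := hcell (p.enum a) ha.2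
    obtain ⟨t, ht, htj⟩ := hj r ⟨_, hr⟩
    obtain ⟨E, hE, hhom, hseg⟩ := trace j G hG n
    refine key t E hE (by rwa [htj]) ?_
    rw [htj, hτ, ht]
    refine ⟨a, ⟨by simpa using ha.1, Set.mem_iInter.1 hr⟩, n, ?_⟩
    rw [← hseg n le_rfl]
    exact hn

/-- The fundamental step: any requirements, one for each color, can be advanced for some color. -/
theorem exists_advances {A₀ A₁ : Set ℚ} (hA : Disjoint A₀ A₁) (h𝒮 : IsScottSet 𝒮)
    (hfair : ∀ X ∈ 𝒮, IsFair p A₀ A₁ X) (hC : C ∈ 𝒮)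
    (hf : ∀ i, EnumIn C fun p : ℕ × ℕ => p.1 < p.2 ∧ f p.1 p.2 = i) (c : Condition 𝒮 f)
    (τ : Fin k → Requirement k) :
    ∃ d : Condition 𝒮 f, d.Extends c ∧ ∃ i, d.Advances p A₀ A₁ C c i (τ i) := by
  -- The rows of the `dense` requirements form the matrix; the other rows are arbitrary.
  have hrow : ∀ i, ∃ y : Fin k → ℚ, StrictMono y ∧ ∀ e x hx, τ i = .dense e x hx → y = x := by
    intro i
    cases τ i with
    | dense e x hx => exact ⟨x, hx, fun e' x' hx' h => by injection h⟩
    | _ =>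
      exact ⟨fun j => (j : ℕ), fun a b h => by simpa using h, fun _ _ _ h => by simp at h⟩
  choose y hy hyτ using hrow
  let M : RatMatrix k k := ⟨y, hy⟩
  by_cases hess : (badFormula p f C c.reservoir c.stem τ).IsEssential p M
  · obtain ⟨v, ⟨hR, hS⟩, hv⟩ := hfair _ (h𝒮.join_mem _ c.mem C hC) k k M _
      (isSigmaOne_badFormula hf c.reservoir c.stem τ) hess
    exact exists_advances_of_allBad hA h𝒮 hC hf c τ (fun i => Set.preimage_mono (hR i))
      (fun i => (hS i).imp fun l h => Set.preimage_mono h) hv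
  · exact exists_advances_of_not_essential A₀ A₁ h𝒮 hC hf c τ (M := M) hyτ hess

end Progress

/-! ### Dense sets of rationals -/

section Dense

variable {D : Set ℚ}

theorem IsDenseSubset.exists_strictMono (hD : IsDenseSubset D) {a b : ℚ} (ha : a ∈ D) (hb : b ∈ D)
    (hab : a < b) : ∃ u : ℕ → ℚ, StrictMono u ∧ ∀ n, u n ∈ D ∧ a < u n ∧ u n < b := by
  have hnext : ∀ q : {q // q ∈ D ∧ a ≤ q ∧ q < b}, ∃ q' : {q // q ∈ D ∧ a ≤ q ∧ q < b},
      q.1 < q'.1 := by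
    rintro ⟨q, hq, haq, hqb⟩
    obtain ⟨z, hz, h1, h2⟩ := hD.2 q hq b hb hqb
    exact ⟨⟨z, hz, haq.trans h1.le, h2⟩, h1⟩
  choose next hnext using hnext
  let v : ℕ → {q // q ∈ D ∧ a ≤ q ∧ q < b} := fun n => next^[n] ⟨a, ha, le_rfl, hab⟩
  have hv : StrictMono fun n => (v n).1 := strictMono_nat_of_lt_succ fun n => by
    simp only [v, Function.iterate_succ_apply']
    exact hnext _
  refine ⟨fun n => (v (n + 1)).1, fun m n h => hv (Nat.succ_lt_succ h), fun n =>
    ⟨(v (n + 1)).2.1, ?_, (v (n + 1)).2.2.2⟩⟩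
  exact (v 0).2.2.1.trans_lt (hv n.succ_pos)

theorem IsDenseSubset.exists_row (hD : IsDenseSubset D) (k : ℕ) :
    ∃ x : Fin k → ℚ, StrictMono x ∧ ∀ l, (D ∩ rowInterval x l).Infinite := by
  obtain ⟨a, ha, b, hb, hab⟩ := hD.1.exists_lt
  obtain ⟨u, hu, huD⟩ := hD.exists_strictMono ha hb hab
  refine ⟨fun j => u (j + 1), fun i j h => hu (Nat.succ_lt_succ h), fun l => ?_⟩
  obtain ⟨w, hw, hwD⟩ := hD.exists_strictMono (huD l).1 (huD (l + 1)).1 (hu (Nat.lt_succ_self l))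
  refine Set.infinite_of_injective_forall_mem hw.injective fun n => ⟨(hwD n).1, ?_, ?_⟩
  · exact fun j hj => (hu.monotone (Nat.succ_le_of_lt hj)).trans_lt (hwD n).2.1
  · exact fun j hj => (hwD n).2.2.trans_le (hu.monotone (Nat.succ_le_succ hj))

end Dense

/-! ### The generic sets -/

section Generic

theorem countable_subtype_primrec (α β : Type*) [Primcodable α] [Primcodable β] :
    Countable {g : α → β // Primrec g} := by
  have h : ∀ g : {g : α → β // Primrec g}, ∃ c : Nat.Partrec.Code, c.eval =
      ((fun n => Encodable.encode ((Encodable.decode n).map g.1) : ℕ → ℕ) : ℕ →. ℕ) := fun g =>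
    Nat.Partrec.Code.exists_code.1 (Nat.Partrec.of_primrec g.2)
  choose c hc using h
  refine Function.Injective.countable (f := c) fun g g' hgg => ?_
  have h := (hc g).symm.trans (hgg ▸ hc g')
  refine Subtype.ext (funext fun a => ?_)
  have ha := Part.some_inj.1 (congrFun h (Encodable.encode a))
  simpa using ha

instance : Countable EnumOperator := by
  classical
  have := countable_subtype_primrec (List Bool × ℕ) Bool
  let F : EnumOperator → {g : List Bool × ℕ → Bool // Primrec g} := fun e =>
    ⟨fun q => decide (e.1 q.1 q.2), e.2.decide⟩
  refine Function.Injective.countable (f := F) fun e e' h => ?_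
  refine Subtype.ext (funext fun σ => funext fun a => ?_)
  have h' := congrFun (congrArg Subtype.val h) (σ, a)
  exact propext (decide_eq_decide.1 h')

instance (k : ℕ) : Countable (Requirement k) := by
  let F : Requirement k → Option (EnumOperator × Option (Fin k → ℚ)) := fun r =>
    match r with
    | .grow => none
    | .thin e => some (e, none)
    | .dense e x _ => some (e, some x)
  refine Function.Injective.countable (f := F) fun r r' h => ?_
  cases r <;> cases r' <;> simp_all [F]

variable {k : ℕ} {𝒮 : Set (Set ℕ)} {f : ℕ → ℕ → Fin k} {C : Set ℕ} {p : RatPresentation}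
  {A₀ A₁ : Set ℚ}

/-- A sequence of conditions that treats each tuple of requirements infinitely often produces, for
some color, a homogeneous set satisfying all requirements: otherwise a tuple that consists of
a failing requirement for each color would never have been advanced often enough. -/
theorem exists_generic (h𝒮 : IsScottSet 𝒮) (hC : C ∈ 𝒮)
    (hstep : ∀ (c : Condition 𝒮 f) (τ : Fin k → Requirement k), ∃ d : Condition 𝒮 f,
      d.Extends c ∧ ∃ i, d.Advances p A₀ A₁ C c i (τ i)) :
    ∃ i, ∃ G : Set ℕ, (∀ x ∈ G, ∀ y ∈ G, x < y → f x y = i) ∧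
      ∀ r : Requirement k, r.Holds p A₀ A₁ C G := by
  have : Nonempty (Requirement k) := ⟨.grow⟩
  obtain ⟨task, htask⟩ := exists_surjective_nat ((Fin k → Requirement k) × ℕ)
  choose next hext col hadv using hstep
  have huniv : (Set.univ : Set ℕ) ∈ 𝒮 := h𝒮.mem_of_primrecPred hC
    ((Primrec.eq.comp (.const 0) (.const 0)).of_eq fun n => by simp)
  let c₀ : Condition 𝒮 f := ⟨fun _ => ∅, Set.univ, huniv, Set.infinite_univ, by simp, by simp⟩
  let c : ℕ → Condition 𝒮 f := fun n => n.rec c₀ fun m c => next c (task m).1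
  have hc : ∀ {m n}, m ≤ n → (c n).Extends (c m) := fun {m n} h => by
    induction n, h using Nat.le_induction with
    | base => exact .refl _
    | succ n _ ih => exact (hext (c n) (task n).1).trans ih
  let win : ℕ → Fin k := fun n => col (c n) (task n).1
  have hwin : ∀ τ, ∃ i, ({n | (task n).1 = τ} ∩ {n | win n = i}).Infinite := by
    intro τ
    refine exists_infinite_inter ?_ fun n _ => ⟨win n, rfl⟩
    choose g hg using fun m => htask (τ, m)
    refine Set.infinite_of_injective_forall_mem (f := g) (fun m m' h => ?_) fun m => ?_
    · have h' := (hg m).symm.trans ((congrArg task h).trans (hg m'))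
      exact (Prod.ext_iff.1 h').2
    · exact congrArg Prod.fst (hg m)
  obtain ⟨i, hi⟩ : ∃ i, ∀ r, {n | (task n).1 i = r ∧ win n = i}.Infinite := by
    by_contra! h
    choose r hr using h
    obtain ⟨i, hi⟩ := hwin r
    exact hi ((hr i).subset fun n hn => ⟨congrFun hn.1 i, hn.2⟩)
  let G : Set ℕ := ⋃ n, ((c n).stem i : Set ℕ)
  have hG : ∀ x ∈ G, ∀ y ∈ G, x < y → f x y = i := by
    intro x hx y hy
    obtain ⟨m, hm⟩ := Set.mem_iUnion.1 hx
    obtain ⟨n, hn⟩ := Set.mem_iUnion.1 hy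
    exact (c (max m n)).homogeneous i x ((hc (le_max_left m n)).stem_subset i hm) y
      ((hc (le_max_right m n)).stem_subset i hn)
  have hallow : ∀ n, (c n).Allows i G := by
    refine fun n => ⟨Set.subset_iUnion (fun n => ((c n).stem i : Set ℕ)) n, fun x hx => ?_, hG⟩
    obtain ⟨m, hm⟩ := Set.mem_iUnion.1 hx
    rcases le_total m n with h | h
    · exact Or.inl ((hc h).stem_subset i hm)
    · exact (hc h).subset_union i hm
  refine ⟨i, G, hG, fun r => ?_⟩
  by_cases hr : r = .grow
  · subst hr
    intro hfin
    have hcard : ∀ b, ∃ n, b ≤ ((c n).stem i).card := by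
      intro b
      induction b with
      | zero => exact ⟨0, Nat.zero_le _⟩
      | succ b ih =>
        obtain ⟨n, hn⟩ := ih
        obtain ⟨n', ⟨h1, h2⟩, h3⟩ := (hi .grow).exists_gt n
        have h4 := (hadv (c n') (task n').1).1
        rw [show col (c n') (task n').1 = i from h2] at h4
        exact ⟨n' + 1, (hn.trans (Finset.card_le_card ((hc h3.le).stem_subset i))).trans_lt
          (Finset.card_lt_card (h4 h1))⟩
    obtain ⟨n, hn⟩ := hcard (hfin.toFinset.card + 1)
    have hle : ((c n).stem i).card ≤ hfin.toFinset.card := Finset.card_le_card fun x hx =>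
      hfin.mem_toFinset.2 ((hallow n).stem_subset hx)
    omega
  · obtain ⟨n, h1, h2⟩ := (hi r).nonempty
    have h4 := (hadv (c n) (task n).1).2
    rw [show col (c n) (task n).1 = i from h2, show (task n).1 i = r from h1] at h4
    exact h4 hr G (hallow (n + 1))

end Generic

/-- A set of rationals computable from `X` is given by some enumeration operator. -/
theorem RatPresentation.Computes.exists_apply_eq {p : RatPresentation} {X : Set ℕ} {D : Set ℚ}
    (h : p.Computes X D) : ∃ e : EnumOperator, e.apply X = p.enum ⁻¹' D := by
  obtain ⟨R, hR, hRD⟩ := h.enumIn_mem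
  refine ⟨⟨R, hR⟩, Set.ext fun a => (hRD a).symm.trans ?_⟩
  have : p.index '' D = p.enum ⁻¹' D := Equiv.image_symm_eq_preimage p.enum D
  rw [this]

theorem IsComputableColoring.enumIn {k : ℕ} {C : Set ℕ} {f : ℕ → ℕ → Fin k}
    (hf : IsComputableColoring C f) (i : Fin k) :
    EnumIn C fun p : ℕ × ℕ => p.1 < p.2 ∧ f p.1 p.2 = i := by
  obtain ⟨g, hg, hgf⟩ := hf
  refine ((EnumIn.of_primrec (Primrec.nat_lt.comp .fst .snd)).and ((EnumIn.graph hg).comp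
    (f := fun p : ℕ × ℕ => (p, (i : ℕ))) (Primrec.id.pair (.const (i : ℕ))))).of_iff fun q => ?_
  refine and_congr_right fun hq => ?_
  constructor
  · rintro rfl
    exact hgf _ _ hq
  · exact fun h => Fin.ext (Part.mem_unique (hgf _ _ hq) h)

end ERFair

theorem mainTheorem3 (p : ERFair.RatPresentation) (A₀ A₁ : Set ℚ) (hA : Disjoint A₀ A₁)
    (𝒮 : Set (Set ℕ)) (h𝒮 : ERFair.IsScottSet 𝒮)
    (hfair : ∀ X ∈ 𝒮, ERFair.IsFair p A₀ A₁ X)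
    (C : Set ℕ) (hC : C ∈ 𝒮) (k : ℕ) (f : ℕ → ℕ → Fin k)
    (hf : ERFair.IsComputableColoring C f) :
    ∃ H : Set ℕ, H.Infinite ∧ ERFair.IsHomogeneous f H ∧
      (¬ ∃ D : Set ℚ, D ⊆ A₀ ∧ D.Infinite ∧ p.Computes (ERFair.join H C) D) ∧
      (¬ ∃ D : Set ℚ, D ⊆ A₁ ∧ ERFair.IsDenseSubset D ∧ p.Computes (ERFair.join H C) D) := by
  obtain ⟨i, H, hhom, hH⟩ := ERFair.exists_generic h𝒮 hC
    (ERFair.exists_advances hA h𝒮 hfair hC hf.enumIn)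
  refine ⟨H, hH .grow, ⟨i, hhom⟩, ?_, ?_⟩
  · rintro ⟨D, hD, hinf, hcomp⟩
    obtain ⟨e, he⟩ := hcomp.exists_apply_eq
    refine hH (.thin e) (he ▸ ⟨Set.preimage_mono hD, ?_⟩)
    exact hinf.preimage (by simp [p.enum.surjective.range_eq])
  · rintro ⟨D, hD, hdense, hcomp⟩
    obtain ⟨e, he⟩ := hcomp.exists_apply_eq
    obtain ⟨x, hx, hinf⟩ := hdense.exists_row k
    refine hH (.dense e x hx) (he ▸ ⟨Set.preimage_mono hD, fun l => ?_⟩)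
    rw [← Set.preimage_inter]
    exact (hinf l).preimage (by simp [p.enum.surjective.range_eq])
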